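/- Let $R$ be an associative ring with $1$, let $\mathsf{Mod}(R)$ be the category of right $R$-modules, let $\mathsf{mod}(R^{op})$ be the category of finitely presented left $R$-modules and let $(\mathsf{mod}(R^{op}),\mathsf{Ab})$ be the category of additive functors $\mathsf{mod}(R^{op})\to\mathsf{Ab}$. A functor $F:\mathsf{Mod}(R)\to\mathsf{Ab}$ is finitely presented if there are modules $X,Y$ and natural transformations $(Y,-)\to(X,-)\to F\to 0$ that are exact at every module, where $(X,-)=\operatorname{Hom}_R(X,-)$; these functors and their natural transformations form the abelian category $\mathsf{fp}(\mathsf{Mod}(R),\mathsf{Ab})$, whose projectives are the representable functors. Let $\mathsf{Y}(X)=(X,-)$, let $w:\mathsf{fp}(\mathsf{Mod}(R),\mathsf{Ab})\to\mathsf{Mod}(R)$ be the contravariant functor adjoint to $\mathsf{Y}$, so that $\operatorname{Nat}(F,(X,-))\cong\operatorname{Hom}_R(X,w(F))$, let $t(X)=X\otimes_R-$, and let $\mathsf{ev}_R(G)=G(R)$. The category $(\mathsf{mod}(R^{op}),\mathsf{Ab})$ is abelian with enough injectives. Define contravariant functors as follows. * $\mathsf{D}_A=R_0(t\circ w):\mathsf{fp}(\mathsf{Mod}(R),\mathsf{Ab})\to(\mathsf{mod}(R^{op}),\mathsf{Ab})$,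 the zeroth right derived functor of $t\circ w$, computed with projective resolutions. There is a canonical isomorphism $\mathsf{D}_A(X,-)\cong X\otimes-$. * $\mathsf{D}_L=L^0(\mathsf{Y}\circ\mathsf{ev}_R):(\mathsf{mod}(R^{op}),\mathsf{Ab})\to\mathsf{fp}(\mathsf{Mod}(R),\mathsf{Ab})$, the zeroth left derived functor of $\mathsf{Y}\circ\mathsf{ev}_R$, computed with injective resolutions. Let $\gamma:\mathsf{D}_L\mathsf{D}_A\to 1$ be the unique natural transformation whose component at $(X,-)$ is the composite $\mathsf{D}_L\mathsf{D}_A(X,-)\cong\mathsf{D}_L(X\otimes-)\to(X\otimes_R R,-)\cong(X,-)$, the middle map being the canonical transformation $L^0(\mathsf{Y}\circ\mathsf{ev}_R)\to\mathsf{Y}\circ\mathsf{ev}_R$ at $X\otimes-$. A short exact sequence $0\to A\to B\to C\to 0$ in $\mathsf{Mod}(R)$ is pure exact if $0\to A\otimes-\to B\otimes-\to C\otimes-\to 0$ is exact in $(\mathsf{mod}(R^{op}),\mathsf{Ab})$. A module $M$ is pure-injective if for every pure exact $0\to A\to B\to C\to 0$ every homomorphism $A\to M$ extends to $B$. A functor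 $F$ arises from a pure exact sequence if there are a pure exact sequence $0\to X\to Y\to Z\to 0$ and an exact sequence $0\to(Z,-)\to(Y,-)\to(X,-)\to F\to 0$ in which the maps between representables are the induced ones. **Proposition.** For every $F\in\mathsf{fp}(\mathsf{Mod}(R),\mathsf{Ab})$ the following are equivalent. 1. $\mathsf{D}_A F=0$. 2. $F$ arises from a pure exact sequence. 3. $F(M)=0$ for every pure-injective $M$. 4. $\operatorname{Nat}((M,-),F)=0$ for every pure-injective $M$. 5. $\operatorname{Nat}(\mathsf{D}_L G,F)=0$ for every $G\in(\mathsf{mod}(R^{op}),\mathsf{Ab})$. 6. $\gamma_F=0$. -/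

import Mathlib

open CategoryTheory CategoryTheory.Limits Opposite
universe v₁ v₂ u₁ u₂ u
noncomputable section
namespace AGJ

section RightExact

section aux
variable {D : Type u₂} [Category.{v₂} D] [Abelian D]
def toHomologyZero (K : ChainComplex D ℕ) : K.X 0 ⟶ K.homology 0 :=
  K.pOpcycles 0 ≫ (ChainComplex.isoHomologyι₀ K).inv

instance (K : ChainComplex D ℕ) : Epi (toHomologyZero K) := by
  unfold toHomologyZero; infer_instance

lemma d_toHomologyZero (K : ChainComplex D ℕ) : K.d 1 0 ≫ toHomologyZero K = 0 := by
  simp [toHomologyZero]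

lemma toHomologyZero_desc (K : ChainComplex D ℕ) {Z : D} (g : K.X 0 ⟶ Z)
    (hg : K.d 1 0 ≫ g = 0) : ∃ g' : K.homology 0 ⟶ Z, toHomologyZero K ≫ g' = g :=
  ⟨(ChainComplex.isoHomologyι₀ K).hom ≫ K.descOpcycles g 1 (by simp) hg,
    by simp [toHomologyZero]⟩

lemma toHomologyZero_naturality {K L : ChainComplex D ℕ} (φ : K ⟶ L) :
    φ.f 0 ≫ toHomologyZero L = toHomologyZero K ≫ HomologicalComplex.homologyMap φ 0 := by
  have h2 := ChainComplex.isoHomologyι₀_inv_naturality φ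
  have h3 := HomologicalComplex.p_opcyclesMap φ 0
  unfold toHomologyZero
  rw [← reassoc_of% h3, Category.assoc, h2]

variable {X Y : D} (P : ProjectiveResolution X) (Q : ProjectiveResolution Y)

def resAug : P.complex.X 0 ⟶ X := P.π.f 0

instance : Epi (resAug P) := inferInstanceAs (Epi (P.π.f 0))

lemma exists_lift_resAug {V : D} [Projective V] (x : V ⟶ X) :
    ∃ y : V ⟶ P.complex.X 0, y ≫ resAug P = x :=
  ⟨Projective.factorThru x (resAug P), Projective.factorThru_comp x (resAug P)⟩

/-- A map out of a projective that dies in the resolved object factors through `d 1 0`. -/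
lemma exists_lift_d {V : D} [Projective V]
    (x : V ⟶ P.complex.X 0) (hx : x ≫ resAug P = 0) :
    ∃ y : V ⟶ P.complex.X 1, y ≫ P.complex.d 1 0 = x :=
  ⟨P.exact₀.liftFromProjective x hx, P.exact₀.liftFromProjective_comp x hx⟩

lemma exists_resLift (f : X ⟶ Y) : ∃ φ : P.complex ⟶ Q.complex,
    φ.f 0 ≫ resAug Q = resAug P ≫ f :=
  ⟨ProjectiveResolution.lift f P Q, ProjectiveResolution.lift_commutes_zero f P Q⟩

lemma d_resAug : P.complex.d 1 0 ≫ resAug P = 0 := P.complex_d_comp_π_f_zero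
end aux

variable {C : Type u₁} [Category.{v₁} C] [Abelian C] [EnoughProjectives C]
  {D : Type u₂} [Category.{v₂} D] [Abelian D] (S : C ⥤ D) [S.Additive]

def leftDerivedZeroAug {X : C} (P : ProjectiveResolution X) :
    S.obj (P.complex.X 0) ⟶ (S.leftDerived 0).obj X :=
  CategoryStruct.comp (X := S.obj (P.complex.X 0)) (toHomologyZero
    ((S.mapHomologicalComplex (ComplexShape.down ℕ)).obj P.complex)) (P.isoLeftDerivedObj S 0).inv

instance {X : C} (P : ProjectiveResolution X) : Epi (leftDerivedZeroAug S P) :=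
  let e : (S.leftDerived 0).obj X ≅
    ((S.mapHomologicalComplex (ComplexShape.down ℕ)).obj P.complex).homology 0 :=
      P.isoLeftDerivedObj S 0
  epi_comp (toHomologyZero ((S.mapHomologicalComplex (ComplexShape.down ℕ)).obj P.complex)) e.inv

lemma d_leftDerivedZeroAug {X : C} (P : ProjectiveResolution X) :
    S.map (P.complex.d 1 0) ≫ leftDerivedZeroAug S P = 0 :=
  (Category.assoc _ _ _).symm.trans ((congrArg (· ≫ (P.isoLeftDerivedObj S 0).inv)
    (d_toHomologyZero ((S.mapHomologicalComplex (ComplexShape.down ℕ)).obj P.complex))).trans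
      zero_comp)

lemma leftDerivedZeroAug_desc {X : C} (P : ProjectiveResolution X) {Z : D}
    (g : S.obj (P.complex.X 0) ⟶ Z) (hg : S.map (P.complex.d 1 0) ≫ g = 0) :
    ∃ g' : (S.leftDerived 0).obj X ⟶ Z, leftDerivedZeroAug S P ≫ g' = g := by
  obtain ⟨g', hg'⟩ := toHomologyZero_desc
    ((S.mapHomologicalComplex (ComplexShape.down ℕ)).obj P.complex) g hg
  refine ⟨(P.isoLeftDerivedObj S 0).hom ≫ g', ?_⟩
  rw [← hg']
  exact (Category.assoc _ _ _).trans (congrArg (toHomologyZero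
    ((S.mapHomologicalComplex (ComplexShape.down ℕ)).obj P.complex) ≫ ·)
      (Iso.inv_hom_id_assoc _ _))

lemma leftDerivedZeroAug_naturality {X Y : C} (f : X ⟶ Y) (P : ProjectiveResolution X)
    (Q : ProjectiveResolution Y) (φ : P.complex.X 0 ⟶ Q.complex.X 0)
    (hφ : φ ≫ resAug Q = resAug P ≫ f) :
    S.map φ ≫ leftDerivedZeroAug S Q = leftDerivedZeroAug S P ≫ (S.leftDerived 0).map f := by
  obtain ⟨l, hl⟩ := exists_resLift P Q f
  have key : S.map (l.f 0) ≫ leftDerivedZeroAug S Q =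
      leftDerivedZeroAug S P ≫ (S.leftDerived 0).map f := by
    have h := ProjectiveResolution.isoLeftDerivedObj_inv_naturality f P Q l hl S 0
    have h2 := toHomologyZero_naturality
      ((S.mapHomologicalComplex (ComplexShape.down ℕ)).map l)
    refine (Category.assoc _ _ _).symm.trans ((congrArg (· ≫ (Q.isoLeftDerivedObj S 0).inv)
      h2).trans ((Category.assoc _ _ _).trans ?_))
    exact (congrArg (toHomologyZero
      ((S.mapHomologicalComplex (ComplexShape.down ℕ)).obj P.complex) ≫ ·) h.symm).trans
        (Category.assoc _ _ _).symm
  obtain ⟨y, hy⟩ := exists_lift_d Q (φ - l.f 0) (by rw [Preadditive.sub_comp, hφ, hl, sub_self])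
  rw [← key, ← sub_eq_zero, ← Preadditive.sub_comp, ← S.map_sub, ← hy, S.map_comp,
    Category.assoc, d_leftDerivedZeroAug, comp_zero]

instance leftDerivedZero_additive : (S.leftDerived 0).Additive where
  map_add {X Y f g} := by
    obtain ⟨φ, hφ⟩ := exists_resLift (projectiveResolution X) (projectiveResolution Y) f
    obtain ⟨ψ, hψ⟩ := exists_resLift (projectiveResolution X) (projectiveResolution Y) g
    rw [← cancel_epi (leftDerivedZeroAug S (projectiveResolution X)), Preadditive.comp_add,
      ← leftDerivedZeroAug_naturality S f _ _ _ hφ, ← leftDerivedZeroAug_naturality S g _ _ _ hψ,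
      ← leftDerivedZeroAug_naturality S (f + g) (projectiveResolution X) (projectiveResolution Y)
        (φ.f 0 + ψ.f 0) (by rw [Preadditive.add_comp, Preadditive.comp_add, hφ, hψ]),
      S.map_add, Preadditive.add_comp]

instance leftDerivedZero_preservesCokernel {A B : C} (f : A ⟶ B) :
    PreservesColimit (parallelPair f 0) (S.leftDerived 0) := by
  suffices H : ∀ (c : CokernelCofork f) (hc : IsColimit c),
      Nonempty (IsColimit (c.map (S.leftDerived 0))) from
    ⟨fun {c} hc => ⟨(CokernelCofork.isColimitMapCoconeEquiv c _).symm (H c hc).some⟩⟩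
  intro c hc
  have hw : f ≫ c.π = 0 := CokernelCofork.condition c
  have hep : Epi c.π := Cofork.IsColimit.epi hc
  let P := projectiveResolution A
  let Q := projectiveResolution B
  let W := projectiveResolution c.pt
  obtain ⟨φ', hφ⟩ := exists_resLift P Q f
  obtain ⟨ψ', hψ⟩ := exists_resLift Q W c.π
  obtain ⟨s, hs⟩ : ∃ s : W.complex.X 0 ⟶ Q.complex.X 0, s ≫ resAug Q ≫ c.π = resAug W :=
    ⟨Projective.factorThru (resAug W) (resAug Q ≫ c.π), Projective.factorThru_comp _ _⟩
  generalize φ'.f 0 = φ at *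
  generalize ψ'.f 0 = ψ at *
  have hex : (ShortComplex.mk f c.π hw).Exact := ShortComplex.exact_of_g_is_cokernel _
    (IsColimit.ofIsoColimit hc (Cofork.ext (Iso.refl _) (by simp)))
  have K : ∀ {V : C} [Projective V] (v : V ⟶ Q.complex.X 0), v ≫ resAug Q ≫ c.π = 0 →
      ∃ (a : V ⟶ P.complex.X 0) (b : V ⟶ Q.complex.X 1), v = a ≫ φ + b ≫ Q.complex.d 1 0 := by
    intro V _ v hv
    obtain ⟨a, ha⟩ := exists_lift_resAug P
      (hex.liftFromProjective (v ≫ resAug Q) (by simpa using hv))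
    have ha' : a ≫ resAug P ≫ f = v ≫ resAug Q := by
      rw [← Category.assoc, ha]; exact hex.liftFromProjective_comp _ _
    obtain ⟨b, hb⟩ := exists_lift_d Q (v - a ≫ φ) (by
      rw [Preadditive.sub_comp, Category.assoc, hφ, ha', sub_self])
    exact ⟨a, b, by rw [hb]; abel⟩
  have K2 : ∀ {V : C} [Projective V] (v : V ⟶ Q.complex.X 0), v ≫ resAug Q ≫ c.π = 0 →
      ∀ {Z : D} (g : (S.leftDerived 0).obj B ⟶ Z), (S.leftDerived 0).map f ≫ g = 0 →
        S.map v ≫ leftDerivedZeroAug S Q ≫ g = 0 := by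
    intro V _ v hv Z g hg
    obtain ⟨a, b, rfl⟩ := K v hv
    have h1 := leftDerivedZeroAug_naturality S f P Q φ hφ
    rw [S.map_add, Preadditive.add_comp, S.map_comp, S.map_comp, Category.assoc, Category.assoc,
      reassoc_of% h1, hg, comp_zero, comp_zero, ← Category.assoc (S.map (Q.complex.d 1 0)),
      d_leftDerivedZeroAug, zero_comp, comp_zero, add_zero]
  have hψn := leftDerivedZeroAug_naturality S c.π Q W ψ hψ
  have hwS : (S.leftDerived 0).map f ≫ (S.leftDerived 0).map c.π = 0 := by
    rw [← Functor.map_comp, hw, Functor.map_zero]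
  have heq : S.map s ≫ leftDerivedZeroAug S Q ≫ (S.leftDerived 0).map c.π =
      leftDerivedZeroAug S W := by
    rw [← hψn, ← Category.assoc, ← S.map_comp, ← sub_eq_zero]
    obtain ⟨y, hy⟩ := exists_lift_d W (s ≫ ψ - 𝟙 _) (by
      rw [Preadditive.sub_comp, Category.assoc, hψ, hs, Category.id_comp, sub_self])
    rw [show S.map (s ≫ ψ) ≫ leftDerivedZeroAug S W - leftDerivedZeroAug S W =
      S.map (s ≫ ψ - 𝟙 _) ≫ leftDerivedZeroAug S W by
        rw [S.map_sub, Preadditive.sub_comp, S.map_id, Category.id_comp], ← hy, S.map_comp,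
      Category.assoc, d_leftDerivedZeroAug, comp_zero]
  have hepi : Epi ((S.leftDerived 0).map c.π) := by
    rw [← Category.assoc] at heq
    have : Epi ((S.map s ≫ leftDerivedZeroAug S Q) ≫ (S.leftDerived 0).map c.π) := by
      rw [heq]; infer_instance
    exact epi_of_epi (S.map s ≫ leftDerivedZeroAug S Q) _
  have hdesc : ∀ {Z : D} (g : (S.leftDerived 0).obj B ⟶ Z), (S.leftDerived 0).map f ≫ g = 0 →
      ∃ g' : (S.leftDerived 0).obj c.pt ⟶ Z, (S.leftDerived 0).map c.π ≫ g' = g := by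
    intro Z g hg
    obtain ⟨g', hg'⟩ := leftDerivedZeroAug_desc S W (S.map s ≫ leftDerivedZeroAug S Q ≫ g) (by
      rw [← Category.assoc, ← S.map_comp]
      exact K2 _ (by rw [Category.assoc, hs, d_resAug]) g hg)
    refine ⟨g', ?_⟩
    rw [← cancel_epi (leftDerivedZeroAug S Q), ← Category.assoc, ← hψn, Category.assoc, hg',
      ← Category.assoc, ← S.map_comp, ← sub_eq_zero]
    rw [show S.map (ψ ≫ s) ≫ leftDerivedZeroAug S Q ≫ g - leftDerivedZeroAug S Q ≫ g =
      S.map (ψ ≫ s - 𝟙 _) ≫ leftDerivedZeroAug S Q ≫ g by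
        rw [S.map_sub, Preadditive.sub_comp, S.map_id, Category.id_comp]]
    exact K2 _ (by rw [Preadditive.sub_comp, Category.assoc, hs, hψ, Category.id_comp, sub_self])
      g hg
  exact ⟨CokernelCofork.IsColimit.ofπ _ hwS (fun g hg => (hdesc g hg).choose)
    (fun g hg => (hdesc g hg).choose_spec)
    (fun g hg m hm => by
      rw [← cancel_epi ((S.leftDerived 0).map c.π)]
      exact hm.trans (hdesc g hg).choose_spec.symm)⟩
end RightExact

section Tensor
open TensorProduct
variable (R : Type u) [Ring R]

/-- The subgroup of `X ⊗_ℤ L` generated by the elements `x r ⊗ l - x ⊗ r l`. -/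
def balancedRel (X : ModuleCat.{u} Rᵐᵒᵖ) (L : ModuleCat.{u} R) : AddSubgroup (X ⊗[ℤ] L) :=
  AddSubgroup.closure
    {z | ∃ (x : X) (r : R) (l : L), z = (MulOpposite.op r • x) ⊗ₜ[ℤ] l - x ⊗ₜ[ℤ] (r • l)}

/-- The tensor product `X ⊗_R L` of a right module and a left module. -/
def BalTensor (X : ModuleCat.{u} Rᵐᵒᵖ) (L : ModuleCat.{u} R) : Type u :=
  (X ⊗[ℤ] L) ⧸ balancedRel R X L

instance (X : ModuleCat.{u} Rᵐᵒᵖ) (L : ModuleCat.{u} R) : AddCommGroup (BalTensor R X L) :=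
  inferInstanceAs (AddCommGroup ((X ⊗[ℤ] L) ⧸ balancedRel R X L))

variable {R}

/-- The class of `x ⊗ l` in `X ⊗_R L`. -/
def balTmul {X : ModuleCat.{u} Rᵐᵒᵖ} {L : ModuleCat.{u} R} (x : X) (l : L) : BalTensor R X L :=
  QuotientAddGroup.mk' (balancedRel R X L) (x ⊗ₜ[ℤ] l)

section
variable {X : ModuleCat.{u} Rᵐᵒᵖ} {L : ModuleCat.{u} R}

lemma balTmul_add (x : X) (l l' : L) : balTmul x (l + l') = balTmul x l + balTmul x l' := by
  unfold balTmul; rw [TensorProduct.tmul_add]; exact map_add _ _ _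

lemma add_balTmul (x x' : X) (l : L) : balTmul (x + x') l = balTmul x l + balTmul x' l := by
  unfold balTmul; rw [TensorProduct.add_tmul]; exact map_add _ _ _

lemma balTmul_balanced (x : X) (r : R) (l : L) :
    balTmul (MulOpposite.op r • x) l = balTmul x (r • l) := by
  unfold balTmul
  refine (QuotientAddGroup.eq_iff_sub_mem).2 ?_
  exact AddSubgroup.subset_closure ⟨x, r, l, rfl⟩

lemma balTensor_hom_ext {A : Type*} [AddCommGroup A] {f g : BalTensor R X L →+ A}
    (h : ∀ x l, f (balTmul x l) = g (balTmul x l)) : f = g := by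
  refine QuotientAddGroup.addMonoidHom_ext _ ?_
  ext z
  induction z using TensorProduct.induction_on with
  | zero => simp
  | tmul x l => exact h x l
  | add a b ha hb => rw [map_add, map_add, ha, hb]
end

/-- The map `f ⊗ g : X ⊗_R L → X' ⊗_R L'`. -/
def balMap {X X' : ModuleCat.{u} Rᵐᵒᵖ} {L L' : ModuleCat.{u} R} (f : X ⟶ X') (g : L ⟶ L') :
    BalTensor R X L →+ BalTensor R X' L' :=
  QuotientAddGroup.map (balancedRel R X L) (balancedRel R X' L')
    (TensorProduct.map f.hom.toAddMonoidHom.toIntLinearMap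
      g.hom.toAddMonoidHom.toIntLinearMap).toAddMonoidHom (by
    unfold balancedRel
    rw [AddSubgroup.closure_le]
    rintro _ ⟨x, r, l, rfl⟩
    refine AddSubgroup.subset_closure ⟨f.hom x, r, g.hom l, ?_⟩
    simp)

lemma balMap_tmul {X X' : ModuleCat.{u} Rᵐᵒᵖ} {L L' : ModuleCat.{u} R} (f : X ⟶ X') (g : L ⟶ L')
    (x : X) (l : L) : balMap f g (balTmul x l) = balTmul (f.hom x) (g.hom l) := rfl
end Tensor

section Cats
variable (R : Type u) [Ring R]

/-- Finitely presented left modules. -/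
def isFP : ObjectProperty (ModuleCat.{u} R) := fun L => Module.FinitePresentation R L

/-- `mod(Rᵒᵖ)`: the category of finitely presented left `R`-modules. -/
abbrev LMod := (isFP R).FullSubcategory

/-- `(mod(Rᵒᵖ), Ab)`: additive functors from finitely presented left `R`-modules to abelian
groups. -/
abbrev FunL := LMod R ⥤+ AddCommGrpCat.{u}

/-- The functor `X ⊗ -`. -/
def tensorFunctor (X : ModuleCat.{u} Rᵐᵒᵖ) : LMod R ⥤ AddCommGrpCat.{u} where
  obj L := AddCommGrpCat.of (BalTensor R X L.obj)
  map g := AddCommGrpCat.ofHom (balMap (𝟙 X) g.hom)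
  map_id L := by
    ext1
    refine balTensor_hom_ext fun x l => rfl
  map_comp f g := by
    ext1
    refine balTensor_hom_ext fun x l => rfl

instance (X : ModuleCat.{u} Rᵐᵒᵖ) : (tensorFunctor R X).Additive where
  map_add {L L' f g} := by
    ext1
    refine balTensor_hom_ext fun x l => ?_
    exact balTmul_add _ _ _

/-- The tensor embedding `t(X) = X ⊗ -`. -/
def t : ModuleCat.{u} Rᵐᵒᵖ ⥤ FunL R where
  obj X := AdditiveFunctor.of (tensorFunctor R X)
  map f := ObjectProperty.homMk
    { app := fun L => AddCommGrpCat.ofHom (balMap f (𝟙 L.obj))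
      naturality := fun L L' g => by
        ext1
        refine balTensor_hom_ext fun x l => rfl }
  map_id X := by
    ext L : 4
    refine balTensor_hom_ext fun x l => rfl
  map_comp f g := by
    ext L : 4
    refine balTensor_hom_ext fun x l => rfl

instance : (t R).Additive where
  map_add {X X' f g} := by
    ext L : 4
    refine balTensor_hom_ext fun x l => ?_
    exact add_balTmul _ _ _

/-- The ring as a finitely presented left module over itself. -/
def regMod : LMod R := ⟨ModuleCat.of R R, inferInstanceAs (Module.FinitePresentation R R)⟩

variable {R} in
/-- Right multiplication by `r`, a left module endomorphism of the ring. -/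
def rightMul (r : R) : regMod R ⟶ regMod R :=
  ObjectProperty.homMk (ModuleCat.ofHom (LinearMap.toSpanSingleton R R r))

variable {R} in
lemma regMod_hom_ext {L : LMod R} {f g : regMod R ⟶ L}
    (h : ∀ x : R, f.hom.hom x = g.hom.hom x) : f = g :=
  ObjectProperty.hom_ext _ (ModuleCat.hom_ext (LinearMap.ext h))

lemma rightMul_one : rightMul (1 : R) = 𝟙 (regMod R) :=
  regMod_hom_ext fun x => mul_one x

lemma rightMul_mul (r s : R) : rightMul (r * s) = rightMul r ≫ rightMul s :=
  regMod_hom_ext fun x => (mul_assoc x r s).symm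

lemma rightMul_add (r s : R) : rightMul (r + s) = rightMul r + rightMul s :=
  regMod_hom_ext fun x => mul_add x r s

/-- The right module `G(R)`, with `z r := G(· r)(z)`. -/
def evObj (G : FunL R) : ModuleCat.{u} Rᵐᵒᵖ :=
  letI : Module Rᵐᵒᵖ (G.obj.obj (regMod R)) :=
    { smul := fun r z => G.obj.map (rightMul r.unop) z
      one_smul := fun z => by
        change G.obj.map (rightMul 1) z = z
        rw [rightMul_one, G.obj.map_id]; rfl
      mul_smul := fun r s z => by
        change G.obj.map (rightMul (s.unop * r.unop)) z = _
        rw [rightMul_mul, G.obj.map_comp]; rfl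
      smul_zero := fun r => map_zero (G.obj.map (rightMul r.unop)).hom
      smul_add := fun r => map_add (G.obj.map (rightMul r.unop)).hom
      add_smul := fun r s z => by
        change G.obj.map (rightMul (r.unop + s.unop)) z = _
        rw [rightMul_add, G.obj.map_add]; rfl
      zero_smul := fun z => by
        have h : rightMul (0 : R) = 0 := by
          have := rightMul_add R 0 0
          rw [add_zero] at this
          exact left_eq_add.1 this
        change G.obj.map (rightMul 0) z = 0
        rw [h, G.obj.map_zero]; rfl }
  ModuleCat.of Rᵐᵒᵖ (G.obj.obj (regMod R))

/-- The evaluation `ev_R(G) = G(R)`. -/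
def evR : FunL R ⥤ ModuleCat.{u} Rᵐᵒᵖ where
  obj G := evObj R G
  map {G H} α := ModuleCat.ofHom (X := evObj R G) (Y := evObj R H)
    { toFun := α.hom.app (regMod R)
      map_add' := fun x y => map_add (α.hom.app (regMod R)).hom x y
      map_smul' := fun r x =>
        ConcreteCategory.congr_hom (α.hom.naturality (rightMul r.unop)) x }
  map_id _ := rfl
  map_comp _ _ := rfl

instance : (evR R).Additive where
  map_add := rfl

/-- The natural map `X → X ⊗ R`, `x ↦ x ⊗ 1`. -/
def unitTensor : 𝟭 (ModuleCat.{u} Rᵐᵒᵖ) ⟶ t R ⋙ evR R where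
  app X := ModuleCat.ofHom (X := X) (Y := evObj R ((t R).obj X))
    { toFun := fun x => (balTmul (L := ModuleCat.of R R) x (1 : R) : BalTensor R X (ModuleCat.of R R))
      map_add' := fun x y => add_balTmul _ _ _
      map_smul' := fun r x => by
        refine (balTmul_balanced (L := ModuleCat.of R R) x r.unop (1 : R)).trans ?_
        change _ = balTmul (L := ModuleCat.of R R) x ((1 : R) • r.unop)
        congr 1
        simp }
  naturality X Y f := rfl

end Cats

section Pointwise
variable {E : Type u₁} [Category.{v₁} E]

lemma pointwise_exact {F G H : E ⥤ AddCommGrpCat.{u}} {f : F ⟶ G} {g : G ⟶ H} (w : f ≫ g = 0)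
    (hS : (ShortComplex.mk f g w).Exact) (A : E) (x : G.obj A) (hx : g.app A x = 0) :
    ∃ y : F.obj A, f.app A y = x := by
  have := hS.map ((evaluation E AddCommGrpCat.{u}).obj A)
  rw [ShortComplex.ab_exact_iff] at this
  exact this x hx

lemma pointwise_surj {F G : E ⥤ AddCommGrpCat.{u}} (f : F ⟶ G) [Epi f] (A : E) :
    Function.Surjective (f.app A) :=
  (AddCommGrpCat.epi_iff_surjective _).1 ((NatTrans.epi_iff_epi_app f).1 inferInstance A)

lemma pointwise_inj {F G : E ⥤ AddCommGrpCat.{u}} (f : F ⟶ G) [Mono f] (A : E) :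
    Function.Injective (f.app A) :=
  (AddCommGrpCat.mono_iff_injective _).1 ((NatTrans.mono_iff_mono_app f).1 inferInstance A)

lemma epi_of_pointwise {F G : E ⥤ AddCommGrpCat.{u}} (f : F ⟶ G)
    (h : ∀ A, Function.Surjective (f.app A)) : Epi f :=
  (NatTrans.epi_iff_epi_app f).2 fun A => (AddCommGrpCat.epi_iff_surjective _).2 (h A)

lemma mono_of_pointwise {F G : E ⥤ AddCommGrpCat.{u}} (f : F ⟶ G)
    (h : ∀ A, Function.Injective (f.app A)) : Mono f :=
  (NatTrans.mono_iff_mono_app f).2 fun A => (AddCommGrpCat.mono_iff_injective _).2 (h A)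

lemma isZero_const : IsZero ((Functor.const E).obj (AddCommGrpCat.of PUnit.{u + 1})) :=
  Functor.isZero _ fun _ => AddCommGrpCat.isZero_of_subsingleton (AddCommGrpCat.of PUnit.{u + 1})

variable [Preadditive E]


instance : (additiveFunctor E AddCommGrpCat.{u}).IsClosedUnderSubobjects where
  prop_of_mono {F G} f _ (hG : G.Additive) := by
    refine ⟨fun {X Y a b} => ?_⟩
    have : Mono (f.app Y) := (NatTrans.mono_iff_mono_app f).1 inferInstance Y
    rw [← cancel_mono (f.app Y), f.naturality, G.map_add, Preadditive.comp_add,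
      Preadditive.add_comp, f.naturality, f.naturality]

instance : (additiveFunctor E AddCommGrpCat.{u}).IsClosedUnderQuotients where
  prop_of_epi {F G} f _ (hF : F.Additive) := by
    refine ⟨fun {X Y a b} => ?_⟩
    have : Epi (f.app X) := (NatTrans.epi_iff_epi_app f).1 inferInstance X
    rw [← cancel_epi (f.app X), ← f.naturality, F.map_add, Preadditive.comp_add,
      Preadditive.add_comp, f.naturality, f.naturality]

instance : (additiveFunctor E AddCommGrpCat.{u}).ContainsZero where
  exists_zero := ⟨_, isZero_const, ⟨fun {_ _ _ _} =>
    (AddCommGrpCat.isZero_of_subsingleton (AddCommGrpCat.of PUnit.{u + 1})).eq_of_src _ _⟩⟩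

instance : (additiveFunctor E AddCommGrpCat.{u}).IsClosedUnderFiniteProducts where
  isClosedUnderLimitsOfShape J _ := ⟨by
    rintro F ⟨p⟩
    refine ⟨fun {X Y a b} => ?_⟩
    refine (isLimitOfPreserves ((evaluation E AddCommGrpCat.{u}).obj Y) p.isLimit).hom_ext
      fun j => ?_
    have hj : (p.diag.obj j).Additive := p.prop_diag_obj j
    have h : ∀ c : X ⟶ Y, F.map c ≫ (p.π.app j).app Y = (p.π.app j).app X ≫ (p.diag.obj j).map c :=
      fun c => (p.π.app j).naturality c
    change F.map (a + b) ≫ (p.π.app j).app Y = (F.map a + F.map b) ≫ (p.π.app j).app Y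
    rw [h, Functor.map_add, Preadditive.comp_add, Preadditive.add_comp, h, h]⟩
end Pointwise

section FunLAbelian
variable (R : Type u) [Ring R]

instance : Abelian (FunL R) := inferInstance

lemma funL_inj {G H : FunL R} (α : G ⟶ H) [Mono α] (L : LMod R) :
    Function.Injective (α.hom.app L) := by
  have := (additiveFunctor (LMod R) AddCommGrpCat.{u}).preservesMonomorphisms_ι_of_isNormalEpiCategory
  have : Mono α.hom :=
    inferInstanceAs (Mono ((additiveFunctor (LMod R) AddCommGrpCat.{u}).ι.map α))
  exact pointwise_inj α.hom L

lemma funL_mono {G H : FunL R} (α : G ⟶ H) (h : ∀ L, Function.Injective (α.hom.app L)) :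
    Mono α :=
  have : Mono ((additiveFunctor (LMod R) AddCommGrpCat.{u}).ι.map α) := mono_of_pointwise α.hom h
  (additiveFunctor (LMod R) AddCommGrpCat.{u}).ι.mono_of_mono_map this

/-- A small set of representatives of the finitely presented left modules. -/
def FPIndex : Type u := Σ n : ℕ, {N : Submodule R (Fin n → R) // N.FG}

def fpRep (i : FPIndex R) : LMod R :=
  ⟨ModuleCat.of R ((Fin i.1 → R) ⧸ i.2.1),
    Module.finitePresentation_of_surjective i.2.1.mkQ i.2.1.mkQ_surjective
      (by rw [Submodule.ker_mkQ]; exact i.2.2)⟩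

lemma exists_fpRep (L : LMod R) : ∃ i, Nonempty (L ≅ fpRep R i) := by
  have : Module.FinitePresentation R L.obj := L.property
  obtain ⟨n, K, e, hK⟩ := Module.FinitePresentation.exists_fin R L.obj
  exact ⟨⟨n, K, hK⟩, ⟨(isFP R).isoMk (LinearEquiv.toModuleIso e)⟩⟩

variable {R}

/-- The functor `Y ↦ ∏ᵢ Hom_ℤ(Hom_R(Y, Xᵢ), Eᵢ)`. -/
def coindFunctor (E : FPIndex R → AddCommGrpCat.{u}) : LMod R ⥤ AddCommGrpCat.{u} where
  obj Y := AddCommGrpCat.of (∀ i, (Y ⟶ fpRep R i) →+ E i)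
  map {Y Y'} f := AddCommGrpCat.ofHom
    { toFun := fun z i => (z i).comp (Preadditive.leftComp (fpRep R i) f)
      map_zero' := rfl
      map_add' := fun _ _ => rfl }
  map_id Y := by
    ext z i h
    exact congrArg (z i) (Category.id_comp h)
  map_comp f g := by
    ext z i h
    exact congrArg (z i) (Category.assoc f g h)

instance (E : FPIndex R → AddCommGrpCat.{u}) : (coindFunctor E).Additive where
  map_add {Y Y' f g} := by
    ext z
    funext i
    ext h
    exact (congrArg (z i) (Preadditive.add_comp _ _ _ f g h)).trans (map_add (z i) _ _)

def coind (E : FPIndex R → AddCommGrpCat.{u}) : FunL R := AdditiveFunctor.of (coindFunctor E)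

def toCoind {G : FunL R} {E : FPIndex R → AddCommGrpCat.{u}}
    (e : ∀ i, G.obj.obj (fpRep R i) ⟶ E i) : G ⟶ coind E :=
  ObjectProperty.homMk
    { app := fun Y => AddCommGrpCat.ofHom
        { toFun := fun y i =>
            { toFun := fun h => e i (G.obj.map h y)
              map_zero' := by rw [G.obj.map_zero]; exact map_zero (e i).hom
              map_add' := fun h h' => by rw [G.obj.map_add]; exact map_add (e i).hom _ _ }
          map_zero' := by
            funext i; ext h
            exact (congrArg (e i) (map_zero (G.obj.map h).hom)).trans (map_zero (e i).hom)
          map_add' := fun y y' => by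
            funext i; ext h
            exact (congrArg (e i) (map_add (G.obj.map h).hom y y')).trans
              (map_add (e i).hom _ _) }
      naturality := fun Y Y' f => by
        ext y
        funext i
        ext h
        exact congrArg (e i) (ConcreteCategory.congr_hom (G.obj.map_comp f h) y).symm }

instance (E : FPIndex R → AddCommGrpCat.{u}) [∀ i, Injective (E i)] : Injective (coind E) where
  factors {G H} g f _ := by
    let g' : ∀ i, G.obj.obj (fpRep R i) ⟶ E i := fun i => AddCommGrpCat.ofHom
      { toFun := fun y => (g.hom.app (fpRep R i) y : ∀ j, (fpRep R i ⟶ fpRep R j) →+ E j) i (𝟙 _)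
        map_zero' := by rw [map_zero]; rfl
        map_add' := fun y y' => by rw [map_add]; rfl }
    have hm : ∀ i, Mono (f.hom.app (fpRep R i)) := fun i =>
      (AddCommGrpCat.mono_iff_injective _).2 (funL_inj R f _)
    refine ⟨toCoind fun i => Injective.factorThru (g' i) (f.hom.app (fpRep R i)), ?_⟩
    ext Y y
    funext i
    ext h
    have h1 : H.obj.map h (f.hom.app Y y) = f.hom.app (fpRep R i) (G.obj.map h y) :=
      (ConcreteCategory.congr_hom (f.hom.naturality h) y).symm
    have h2 : Injective.factorThru (g' i) (f.hom.app (fpRep R i))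
        (f.hom.app (fpRep R i) (G.obj.map h y)) = g' i (G.obj.map h y) :=
      ConcreteCategory.congr_hom (Injective.comp_factorThru (g' i) (f.hom.app (fpRep R i))) _
    have h3 := ConcreteCategory.congr_hom (g.hom.naturality h) y
    refine (congrArg _ h1).trans (h2.trans ?_)
    refine (DFunLike.congr_fun (congrFun h3 i) (𝟙 _)).trans ?_
    exact congrArg ((g.hom.app Y y : ∀ j, (Y ⟶ fpRep R j) →+ E j) i) (Category.comp_id h)

instance : EnoughInjectives (FunL R) where
  presentation G := by
    let E : FPIndex R → AddCommGrpCat.{u} := fun i => Injective.under (G.obj.obj (fpRep R i))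
    have : ∀ i, Injective (E i) := fun i => Injective.injective_under _
    let f : G ⟶ coind E := toCoind fun i => Injective.ι _
    refine ⟨⟨coind E, inferInstance, f, funL_mono R f fun L => ?_⟩⟩
    rw [injective_iff_map_eq_zero]
    intro y hy
    obtain ⟨i, ⟨a⟩⟩ := exists_fpRep R L
    have h1 : Injective.ι (G.obj.obj (fpRep R i)) (G.obj.map a.hom y) = 0 :=
      DFunLike.congr_fun (congrFun hy i) a.hom
    have h2 := (AddCommGrpCat.mono_iff_injective (Injective.ι (G.obj.obj (fpRep R i)))).1
      inferInstance
    have h3 : G.obj.map a.hom y = 0 := h2 (h1.trans (map_zero (Injective.ι (G.obj.obj (fpRep R i))).hom).symm)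
    have h4 : G.obj.map a.inv (G.obj.map a.hom y) = y := by
      have := ConcreteCategory.congr_hom (G.obj.map_comp a.hom a.inv) y
      rw [a.hom_inv_id, G.obj.map_id] at this
      exact this.symm
    rw [← h4, h3]
    exact map_zero (G.obj.map a.inv).hom

end FunLAbelian


section FP
variable (R : Type u) [Ring R]

/-- The category of right `R`-modules. -/
abbrev RMod := ModuleCat.{u} Rᵐᵒᵖ

variable {R}

/-- The representable functor `(X, -)`. -/
abbrev rep (X : RMod R) : RMod R ⥤ AddCommGrpCat.{u} := preadditiveCoyoneda.obj (op X)

/-- The natural transformation `(f, -) : (Y, -) → (X, -)`. -/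
abbrev repMap {X Y : RMod R} (f : X ⟶ Y) : rep Y ⟶ rep X := preadditiveCoyoneda.map f.op

/-- `F` is finitely presented: there is a sequence `(Y, -) → (X, -) → F → 0` whose evaluation at
every module is exact. Such functors are automatically additive. -/
def isFPFun (R : Type u) [Ring R] : ObjectProperty (RMod R ⥤ AddCommGrpCat.{u}) := fun F =>
  ∃ (X Y : RMod R) (φ : rep Y ⟶ rep X) (π : rep X ⟶ F), ∀ A : RMod R,
    Function.Exact (φ.app A) (π.app A) ∧ Function.Surjective (π.app A)

/-- The category `fp(Mod(R), Ab)` of finitely presented functors. -/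
abbrev FP (R : Type u) [Ring R] := (isFPFun R).FullSubcategory

/-- The value at `x : X ⟶ A` of a natural transformation `(X, -) → F`. -/
def ev {X : RMod R} {F : RMod R ⥤ AddCommGrpCat.{u}} (π : rep X ⟶ F) {A : RMod R} (x : X ⟶ A) :
    F.obj A := π.app A x

section
variable {X Y A B : RMod R} {F G : RMod R ⥤ AddCommGrpCat.{u}}

lemma ev_comp (π : rep X ⟶ F) (x : X ⟶ A) (a : A ⟶ B) : ev π (x ≫ a) = F.map a (ev π x) :=
  ConcreteCategory.congr_hom (π.naturality a) x

lemma ev_eq (π : rep X ⟶ F) (x : X ⟶ A) : ev π x = F.map x (ev π (𝟙 X)) := by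
  rw [← ev_comp, Category.id_comp]

lemma ev_add (π : rep X ⟶ F) (x y : X ⟶ A) : ev π (x + y) = ev π x + ev π y :=
  map_add (π.app A).hom x y

lemma ev_sub (π : rep X ⟶ F) (x y : X ⟶ A) : ev π (x - y) = ev π x - ev π y :=
  map_sub (π.app A).hom x y

lemma ev_repMap (π : rep X ⟶ F) (f : X ⟶ Y) (y : Y ⟶ A) :
    ev (repMap f ≫ π) y = ev π (f ≫ y) := rfl

lemma ev_post (π : rep X ⟶ F) (α : F ⟶ G) (x : X ⟶ A) :
    ev (π ≫ α) x = α.app A (ev π x) := rfl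

lemma ev_ext {π π' : rep X ⟶ F} (h : ev π (𝟙 X) = ev π' (𝟙 X)) : π = π' := by
  ext A x
  exact (ev_eq π x).trans ((congrArg (F.map x) h).trans (ev_eq π' x).symm)

/-- The natural transformation `(X, -) → F` given by an element of `F(X)`. -/
def ofElem [F.Additive] (z : F.obj X) : rep X ⟶ F where
  app A := AddCommGrpCat.ofHom
    { toFun := fun x : X ⟶ A => F.map x z
      map_zero' := ConcreteCategory.congr_hom (F.map_zero X A) z
      map_add' := fun x y => ConcreteCategory.congr_hom (F.map_add (f := x) (g := y)) z }
  naturality A B a := by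
    ext x
    exact ConcreteCategory.congr_hom (F.map_comp (X := X) x a) z

lemma ev_ofElem [F.Additive] (z : F.obj X) (x : X ⟶ A) : ev (ofElem z) x = F.map x z := rfl

lemma repMap_surj (φ : rep Y ⟶ rep X) : ∃ f : X ⟶ Y, φ = repMap f := by
  obtain ⟨f, hf⟩ := preadditiveCoyoneda.map_surjective φ
  exact ⟨f.unop, hf.symm⟩

end

/-- `(f, -)` and `π` form a presentation of `F`. -/
structure IsPres {X Y : RMod R} {F : RMod R ⥤ AddCommGrpCat.{u}} (f : X ⟶ Y)
    (π : rep X ⟶ F) : Prop where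
  zero_iff : ∀ {A : RMod R} (x : X ⟶ A), ev π x = 0 ↔ ∃ y : Y ⟶ A, f ≫ y = x
  surj : ∀ {A : RMod R} (z : F.obj A), ∃ x : X ⟶ A, ev π x = z

lemma isFPFun_iff (F : RMod R ⥤ AddCommGrpCat.{u}) :
    isFPFun R F ↔ ∃ (X Y : RMod R) (f : X ⟶ Y) (π : rep X ⟶ F), IsPres f π := by
  constructor
  · rintro ⟨X, Y, φ, π, h⟩
    obtain ⟨f, rfl⟩ := repMap_surj φ
    exact ⟨X, Y, f, π, fun {A} x => (h A).1 x, fun {A} z => (h A).2 z⟩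
  · rintro ⟨X, Y, f, π, h⟩
    exact ⟨X, Y, repMap f, π, fun A => ⟨fun x => h.zero_iff (A := A) x, fun z => h.surj z⟩⟩

lemma isFPFun_additive {F : RMod R ⥤ AddCommGrpCat.{u}} (hF : isFPFun R F) : F.Additive := by
  obtain ⟨X, Y, f, π, h⟩ := (isFPFun_iff F).1 hF
  have : Epi π := epi_of_pointwise _ fun A z => h.surj z
  exact (additiveFunctor (RMod R) AddCommGrpCat.{u}).prop_of_epi π
    (inferInstanceAs (Functor.Additive (preadditiveCoyoneda.obj (op X))))

/-- Lifting natural transformations out of representables along a pointwise surjection. -/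
lemma exists_lift {X Y : RMod R} {F : RMod R ⥤ AddCommGrpCat.{u}} (π : rep X ⟶ F)
    (hπ : ∀ {A : RMod R} (z : F.obj A), ∃ x : X ⟶ A, ev π x = z) (α : rep Y ⟶ F) :
    ∃ f : X ⟶ Y, repMap f ≫ π = α := by
  obtain ⟨f, hf⟩ := hπ (ev α (𝟙 Y))
  exact ⟨f, ev_ext (by rw [ev_repMap, Category.comp_id, hf])⟩

lemma IsPres.comp_eq_zero {X Y : RMod R} {F : RMod R ⥤ AddCommGrpCat.{u}} {f : X ⟶ Y}
    {π : rep X ⟶ F} (h : IsPres f π) : repMap f ≫ π = 0 :=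
  ev_ext ((h.zero_iff _).2 ⟨_, rfl⟩)

open ZeroObject in
instance : (isFPFun R).ContainsZero where
  exists_zero := ⟨_, isZero_const, (isFPFun_iff _).2 ⟨0, 0, 0, 0,
    ⟨fun _ => ⟨fun _ => ⟨0, (isZero_zero _).eq_of_src _ _⟩, fun _ => rfl⟩, fun _ => ⟨0, rfl⟩⟩⟩⟩

instance : (isFPFun R).IsClosedUnderIsomorphisms where
  of_iso {F G} e hF := by
    obtain ⟨X, Y, f, π, h⟩ := (isFPFun_iff F).1 hF
    have hi : ∀ A (z : F.obj A), e.inv.app A (e.hom.app A z) = z := fun A z =>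
      ConcreteCategory.congr_hom (e.hom_inv_id_app A) z
    have hi' : ∀ A (z : G.obj A), e.hom.app A (e.inv.app A z) = z := fun A z =>
      ConcreteCategory.congr_hom (e.inv_hom_id_app A) z
    refine (isFPFun_iff G).2 ⟨X, Y, f, π ≫ e.hom, ⟨fun {A} x => ?_, fun {A} z => ?_⟩⟩
    · rw [← h.zero_iff, ev_post]
      refine ⟨fun hx => ?_, fun hx => by rw [hx]; exact map_zero (e.hom.app A).hom⟩
      rw [← hi A (ev π x), hx]; exact map_zero (e.inv.app A).hom
    · obtain ⟨x, hx⟩ := h.surj (e.inv.app A z)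
      exact ⟨x, by rw [ev_post, hx, hi']⟩

instance : (isFPFun R).IsClosedUnderCokernels where
  cokernels_le := by
    rintro _ ⟨φ, c, hc, hF, hG⟩
    rename_i F G
    obtain ⟨XF, YF, f, π, hf⟩ := (isFPFun_iff F).1 hF
    obtain ⟨XG, YG, g, ρ, hg⟩ := (isFPFun_iff G).1 hG
    obtain ⟨a, ha⟩ := exists_lift ρ hg.surj (π ≫ φ)
    have hw : φ ≫ c.π = 0 := CokernelCofork.condition c
    have hep : Epi c.π := Cofork.IsColimit.epi hc
    have hex : (ShortComplex.mk φ c.π hw).Exact := ShortComplex.exact_of_g_is_cokernel _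
      (IsColimit.ofIsoColimit hc (Cofork.ext (Iso.refl _) (by simp)))
    have hw' : ∀ A (z : F.obj A), c.π.app A (φ.app A z) = 0 := fun A z =>
      ConcreteCategory.congr_hom (NatTrans.congr_app hw A) z
    have ha' : ∀ {A} (x : XF ⟶ A), ev ρ (a ≫ x) = φ.app A (ev π x) := fun x => by
      rw [← ev_repMap, ha, ev_post]
    refine (isFPFun_iff _).2 ⟨XG, YG ⊞ XF, biprod.lift g a, ρ ≫ c.π,
      ⟨fun {A} x => ⟨fun hx => ?_, ?_⟩, fun {A} z => ?_⟩⟩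
    · obtain ⟨z, hz⟩ := pointwise_exact hw hex A (ev ρ x) hx
      obtain ⟨y, rfl⟩ := hf.surj z
      rw [← ha', ← sub_eq_zero, ← ev_sub] at hz
      obtain ⟨v, hv⟩ := (hg.zero_iff _).1 hz
      refine ⟨biprod.desc (-v) y, ?_⟩
      rw [biprod.lift_desc, Preadditive.comp_neg, hv]
      abel
    · rintro ⟨y, rfl⟩
      have hy : biprod.lift g a ≫ y = g ≫ (biprod.inl ≫ y) + a ≫ (biprod.inr ≫ y) := by
        rw [← biprod.lift_desc]
        congr 1
        exact biprod.hom_ext' _ _ (by simp) (by simp)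
      rw [hy, ev_post, ev_add, (hg.zero_iff (g ≫ (biprod.inl ≫ y))).2 ⟨_, rfl⟩, zero_add, ha']
      exact hw' _ _
    · obtain ⟨w, hw⟩ := pointwise_surj c.π A z
      obtain ⟨x, rfl⟩ := hg.surj w
      exact ⟨x, hw⟩

instance : (isFPFun R).IsClosedUnderKernels where
  kernels_le := by
    rintro _ ⟨φ, k, hk, hF, hG⟩
    rename_i F G
    have hFadd := isFPFun_additive hF
    obtain ⟨XF, YF, f, π, hf⟩ := (isFPFun_iff F).1 hF
    obtain ⟨XG, YG, g, ρ, hg⟩ := (isFPFun_iff G).1 hG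
    obtain ⟨a, ha⟩ := exists_lift ρ hg.surj (π ≫ φ)
    have hw : k.ι ≫ φ = 0 := KernelFork.condition k
    have hmo : Mono k.ι := Fork.IsLimit.mono hk
    have hex : (ShortComplex.mk k.ι φ hw).Exact := ShortComplex.exact_of_f_is_kernel _
      (IsLimit.ofIsoLimit hk (Fork.ext (Iso.refl _) (by simp)))
    have hKadd : k.pt.Additive :=
      (additiveFunctor (RMod R) AddCommGrpCat.{u}).prop_of_mono k.ι hFadd
    have hw' : ∀ A (z : k.pt.obj A), φ.app A (k.ι.app A z) = 0 := fun A z =>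
      ConcreteCategory.congr_hom (NatTrans.congr_app hw A) z
    have ha' : ∀ {A} (x : XF ⟶ A), ev ρ (a ≫ x) = φ.app A (ev π x) := fun x => by
      rw [← ev_repMap, ha, ev_post]
    have hz0 : φ.app _ (ev π (pushout.inl a g)) = 0 := by
      rw [← ha', hg.zero_iff]
      exact ⟨pushout.inr a g, pushout.condition.symm⟩
    obtain ⟨z0, hz0⟩ := pointwise_exact hw hex _ _ hz0
    have key : ∀ {A} (x : pushout a g ⟶ A),
        k.ι.app A (ev (ofElem z0) x) = ev π (pushout.inl a g ≫ x) := fun {A} x => by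
      rw [ev_ofElem, ev_comp, ← hz0]
      exact ConcreteCategory.congr_hom (k.ι.naturality x) z0
    refine (isFPFun_iff _).2 ⟨pushout a g, pushout (pushout.inl a g) f, pushout.inl _ _,
      ofElem z0, ⟨fun {A} x => ?_, fun {A} z => ?_⟩⟩
    · have h1 : ev (ofElem z0) x = 0 ↔ ev π (pushout.inl a g ≫ x) = 0 := by
        rw [← key]
        refine ⟨fun h => by rw [h]; exact map_zero (k.ι.app A).hom, fun h => ?_⟩
        exact pointwise_inj k.ι A (h.trans (map_zero (k.ι.app A).hom).symm)
      rw [h1, hf.zero_iff]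
      constructor
      · rintro ⟨y, hy⟩
        exact ⟨pushout.desc x y hy.symm, pushout.inl_desc _ _ _⟩
      · rintro ⟨y, rfl⟩
        exact ⟨pushout.inr _ _ ≫ y, by rw [← Category.assoc, ← Category.assoc, pushout.condition]⟩
    · obtain ⟨x, hx⟩ := hf.surj (k.ι.app A z)
      have h2 : ev ρ (a ≫ x) = 0 := by rw [ha', hx, hw']
      obtain ⟨y, hy⟩ := (hg.zero_iff _).1 h2
      refine ⟨pushout.desc x y hy.symm, pointwise_inj k.ι A ?_⟩
      rw [key, pushout.inl_desc, hx]

lemma isFPFun_biprod {F G : RMod R ⥤ AddCommGrpCat.{u}} (hF : isFPFun R F) (hG : isFPFun R G) :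
    isFPFun R (F ⊞ G) := by
  obtain ⟨XF, YF, f, π, hf⟩ := (isFPFun_iff F).1 hF
  obtain ⟨XG, YG, g, ρ, hg⟩ := (isFPFun_iff G).1 hG
  let σ : rep (XF ⊞ XG) ⟶ F ⊞ G :=
    biprod.lift (repMap biprod.inl ≫ π) (repMap biprod.inr ≫ ρ)
  have h1 : ∀ {A} (x : XF ⊞ XG ⟶ A),
      (biprod.fst : F ⊞ G ⟶ F).app A (ev σ x) = ev π (biprod.inl ≫ x) := fun x => by
    rw [← ev_post, ← ev_repMap]
    exact congrArg (fun t => ev t x) (biprod.lift_fst _ _)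
  have h2 : ∀ {A} (x : XF ⊞ XG ⟶ A),
      (biprod.snd : F ⊞ G ⟶ G).app A (ev σ x) = ev ρ (biprod.inr ≫ x) := fun x => by
    rw [← ev_post, ← ev_repMap]
    exact congrArg (fun t => ev t x) (biprod.lift_snd _ _)
  have hext : ∀ {A} (z z' : (F ⊞ G).obj A),
      (biprod.fst : F ⊞ G ⟶ F).app A z = (biprod.fst : F ⊞ G ⟶ F).app A z' →
      (biprod.snd : F ⊞ G ⟶ G).app A z = (biprod.snd : F ⊞ G ⟶ G).app A z' → z = z' := by
    intro A z z' hz hz'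
    have ht : ∀ w : (F ⊞ G).obj A, w =
        (biprod.inl : F ⟶ F ⊞ G).app A ((biprod.fst : F ⊞ G ⟶ F).app A w) +
        (biprod.inr : G ⟶ F ⊞ G).app A ((biprod.snd : F ⊞ G ⟶ G).app A w) := fun w =>
      (ConcreteCategory.congr_hom (NatTrans.congr_app (biprod.total (X := F) (Y := G)) A) w).symm
    rw [ht z, ht z', hz, hz']
  have h0 : ∀ {A}, (biprod.fst : F ⊞ G ⟶ F).app A 0 = 0 ∧ (biprod.snd : F ⊞ G ⟶ G).app A 0 = 0 :=
    fun {A} => ⟨map_zero ((biprod.fst : F ⊞ G ⟶ F).app A).hom,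
      map_zero ((biprod.snd : F ⊞ G ⟶ G).app A).hom⟩
  refine (isFPFun_iff _).2 ⟨XF ⊞ XG, YF ⊞ YG, biprod.map f g, σ,
    ⟨fun {A} x => ⟨fun hx => ?_, ?_⟩, fun {A} z => ?_⟩⟩
  · obtain ⟨y, hy⟩ := (hf.zero_iff (biprod.inl ≫ x)).1 (by rw [← h1, hx, h0.1])
    obtain ⟨y', hy'⟩ := (hg.zero_iff (biprod.inr ≫ x)).1 (by rw [← h2, hx, h0.2])
    exact ⟨biprod.desc y y', biprod.hom_ext' _ _ (by simp [hy]) (by simp [hy'])⟩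
  · rintro ⟨y, rfl⟩
    refine hext _ _ ?_ ?_
    · rw [h1, h0.1, hf.zero_iff]
      exact ⟨biprod.inl ≫ y, by simp⟩
    · rw [h2, h0.2, hg.zero_iff]
      exact ⟨biprod.inr ≫ y, by simp⟩
  · obtain ⟨x, hx⟩ := hf.surj ((biprod.fst : F ⊞ G ⟶ F).app A z)
    obtain ⟨x', hx'⟩ := hg.surj ((biprod.snd : F ⊞ G ⟶ G).app A z)
    refine ⟨biprod.desc x x', hext _ _ ?_ ?_⟩
    · rw [h1, biprod.inl_desc, hx]
    · rw [h2, biprod.inr_desc, hx']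

instance : (isFPFun R).IsClosedUnderFiniteProducts := by
  have : (isFPFun R).IsClosedUnderBinaryProducts := ⟨by
    rintro P ⟨p⟩
    exact (isFPFun R).prop_of_iso (IsLimit.conePointsIsoOfNatIso (BinaryBiproduct.isLimit _ _)
      p.isLimit (diagramIsoPair p.diag).symm)
      (isFPFun_biprod (p.prop_diag_obj ⟨WalkingPair.left⟩) (p.prop_diag_obj ⟨WalkingPair.right⟩))⟩
  exact ObjectProperty.IsClosedUnderFiniteProducts.mk'

instance : Abelian (FP R) := inferInstance

end FP

section Functors
variable {R : Type u} [Ring R]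

lemma IsPres.exists_desc {X Y : RMod R} {F G : RMod R ⥤ AddCommGrpCat.{u}} {f : X ⟶ Y}
    {π : rep X ⟶ F} (h : IsPres f π) (g : rep X ⟶ G) (hg : repMap f ≫ g = 0) :
    ∃ α : F ⟶ G, π ≫ α = g := by
  have hwd : ∀ {A} (x x' : X ⟶ A), ev π x = ev π x' → ev g x = ev g x' := by
    intro A x x' hx
    rw [← sub_eq_zero, ← ev_sub] at hx ⊢
    obtain ⟨y, hy⟩ := (h.zero_iff _).1 hx
    rw [← hy, ← ev_repMap, hg]
    rfl
  choose s hs using fun {A : RMod R} (z : F.obj A) => h.surj z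
  refine ⟨{
    app := fun A => AddCommGrpCat.ofHom
      { toFun := fun z => ev g (s z)
        map_zero' := (hwd _ 0 ((hs _).trans (map_zero (π.app A).hom).symm)).trans
          (map_zero (g.app A).hom)
        map_add' := fun z z' => (hwd _ (s z + s z') (by rw [ev_add, hs, hs, hs])).trans
          (ev_add _ _ _) }
    naturality := fun A B a => ?_ }, ?_⟩
  · ext z
    change ev g (s (F.map a z)) = G.map a (ev g (s z))
    rw [← ev_comp]
    exact hwd _ _ (by rw [hs, ev_comp, hs])
  · ext A x
    exact hwd _ _ (hs (π.app A x))

open ZeroObject in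
lemma isFPFun_rep (X : RMod R) : isFPFun R (rep X) :=
  (isFPFun_iff _).2 ⟨X, 0, 0, 𝟙 _, ⟨fun x => ⟨fun hx => ⟨0, by rw [comp_zero]; exact hx.symm⟩,
    by rintro ⟨y, rfl⟩; rw [zero_comp]; rfl⟩, fun z => ⟨z, rfl⟩⟩⟩

variable (R) in
/-- The Yoneda embedding `Y(X) = (X, -)`. -/
def yo : (RMod R)ᵒᵖ ⥤ FP R :=
  (isFPFun R).lift preadditiveCoyoneda fun X => isFPFun_rep X.unop

instance : (yo R).Additive where
  map_add {X Y f g} := by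
    ext A x
    exact Preadditive.add_comp _ _ _ f.unop g.unop x

lemma fp_surj {F G : FP R} (α : F ⟶ G) [Epi α] (A : RMod R) :
    Function.Surjective (α.hom.app A) := by
  have := (isFPFun R).preservesEpimorphisms_ι_of_isNormalMonoCategory
  have : Epi α.hom := inferInstanceAs (Epi ((isFPFun R).ι.map α))
  exact pointwise_surj α.hom A

instance (X : (RMod R)ᵒᵖ) : Projective ((yo R).obj X) where
  factors {F G} f e _ := by
    obtain ⟨z, hz⟩ := fp_surj e X.unop (ev f.hom (𝟙 _))
    have := isFPFun_additive F.property
    refine ⟨ObjectProperty.homMk (ofElem z), ObjectProperty.hom_ext _ (ev_ext ?_)⟩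
    refine (ev_post (ofElem z) e.hom (𝟙 _)).trans ?_
    rw [ev_ofElem, F.obj.map_id]
    exact hz

lemma IsPres.epi {X Y : RMod R} {F : FP R} {f : X ⟶ Y} {π : rep X ⟶ F.obj} (h : IsPres f π) :
    Epi (ObjectProperty.homMk π : (yo R).obj (op X) ⟶ F) :=
  have : Epi ((isFPFun R).ι.map (ObjectProperty.homMk π : (yo R).obj (op X) ⟶ F)) :=
    epi_of_pointwise π fun _ z => h.surj z
  (isFPFun R).ι.epi_of_epi_map this

lemma IsPres.comp_eq_zero' {X Y : RMod R} {F : FP R} {f : X ⟶ Y} {π : rep X ⟶ F.obj}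
    (h : IsPres f π) :
    (yo R).map f.op ≫ (ObjectProperty.homMk π : (yo R).obj (op X) ⟶ F) = 0 :=
  ObjectProperty.hom_ext _ h.comp_eq_zero

/-- A presentation exhibits `F` as a cokernel in `fp(Mod(R), Ab)`. -/
def IsPres.isColimit {X Y : RMod R} {F : FP R} {f : X ⟶ Y} {π : rep X ⟶ F.obj}
    (h : IsPres f π) :
    IsColimit (CokernelCofork.ofπ (ObjectProperty.homMk π : (yo R).obj (op X) ⟶ F)
      h.comp_eq_zero') :=
  have H : ∀ {G : FP R} (g : (yo R).obj (op X) ⟶ G) (_ : (yo R).map f.op ≫ g = 0),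
      ∃ α : F ⟶ G, (ObjectProperty.homMk π : (yo R).obj (op X) ⟶ F) ≫ α = g := by
    intro G g hg
    obtain ⟨α, hα⟩ := h.exists_desc g.hom (congrArg (fun t => t.hom) hg)
    exact ⟨ObjectProperty.homMk α, ObjectProperty.hom_ext _ hα⟩
  CokernelCofork.IsColimit.ofπ _ _ (fun g hg => (H g hg).choose)
    (fun g hg => (H g hg).choose_spec)
    (fun g hg m hm => by
      have := h.epi
      rw [← cancel_epi (ObjectProperty.homMk π : (yo R).obj (op X) ⟶ F), hm,
        (H g hg).choose_spec])

instance : EnoughProjectives (FP R) where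
  presentation F := by
    obtain ⟨X, Y, f, π, h⟩ := (isFPFun_iff F.obj).1 F.property
    exact ⟨{ p := (yo R).obj (op X), f := ObjectProperty.homMk π, epi := h.epi }⟩

instance : (yo R).IsRightAdjoint := by
  have (F : FP R) : HasInitial (StructuredArrow F (yo R)) := by
    obtain ⟨X, Y, f, π, h⟩ := (isFPFun_iff F.obj).1 F.property
    obtain ⟨η, hη⟩ := h.exists_desc (repMap (kernel.ι f)) (by
      rw [← Functor.map_comp, ← op_comp, kernel.condition, op_zero, Functor.map_zero])
    let I : StructuredArrow F (yo R) :=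
      StructuredArrow.mk (Y := op (kernel f)) (ObjectProperty.homMk η)
    have hep : Epi π := epi_of_pointwise π fun _ z => h.surj z
    have hinj : ∀ {Z Z' : RMod R} (a b : Z ⟶ Z'), repMap a = repMap b → a = b :=
      fun a b hab => Quiver.Hom.op_inj (preadditiveCoyoneda.map_injective hab)
    have hex : ∀ {Z : RMod R} (a : F.obj ⟶ rep Z), ∃ k : Z ⟶ kernel f, η ≫ repMap k = a := by
      intro Z a
      obtain ⟨k, hk⟩ := repMap_surj (π ≫ a)
      have hkf : k ≫ f = 0 := by
        refine hinj _ _ ?_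
        have h1 : repMap (0 : Z ⟶ Y) = 0 := Functor.map_zero preadditiveCoyoneda (op Y) (op Z)
        have h2 : repMap (k ≫ f) = repMap f ≫ repMap k :=
          Functor.map_comp preadditiveCoyoneda f.op k.op
        rw [h1, h2, ← hk, ← Category.assoc, h.comp_eq_zero, zero_comp]
      refine ⟨kernel.lift f k hkf, ?_⟩
      rw [← cancel_epi π, hk, ← Category.assoc, hη, ← Functor.map_comp, ← op_comp,
        kernel.lift_ι]
    choose k hk using fun A : StructuredArrow F (yo R) => hex (Z := A.right.unop) A.hom.hom
    have hun : ∀ {Z : RMod R} (k k' : Z ⟶ kernel f), η ≫ repMap k = η ≫ repMap k' → k = k' := by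
      intro Z k k' hkk
      rw [← cancel_mono (kernel.ι f)]
      refine hinj _ _ ?_
      have h2 : ∀ l : Z ⟶ kernel f, repMap (l ≫ kernel.ι f) = repMap (kernel.ι f) ≫ repMap l :=
        fun l => Functor.map_comp preadditiveCoyoneda (kernel.ι f).op l.op
      rw [h2, h2, ← hη, Category.assoc, Category.assoc, hkk]
    have hI : IsInitial I := IsInitial.ofUniqueHom
      (fun A => StructuredArrow.homMk (k A).op (ObjectProperty.hom_ext _ (hk A)))
      (fun A m => by
        ext1
        refine Quiver.Hom.unop_inj (hun _ _ ?_)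
        exact (congrArg (fun t => t.hom) (StructuredArrow.w m)).trans (hk A).symm)
    exact hI.hasInitial
  exact isRightAdjointOfStructuredArrowInitials _

variable (R) in
/-- Auslander's functor `w`, the left adjoint of the Yoneda embedding. -/
def w : FP R ⥤ (RMod R)ᵒᵖ := (yo R).leftAdjoint

variable (R) in
/-- The adjunction between `w` and the Yoneda embedding. -/
def wAdj : w R ⊣ yo R := Adjunction.ofIsRightAdjoint (yo R)

instance : (w R).Additive := (wAdj R).left_adjoint_additive

variable (R) in
/-- The Auslander-Gruson-Jensen functor `D_A = R_0(t ∘ w)`: since `t ∘ w` is contravariant, its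
zeroth right derived functor (through projective resolutions) is the zeroth left derived functor of
`t ∘ w` regarded as a covariant functor to the opposite category. -/
def DA : FP R ⥤ (FunL R)ᵒᵖ := (w R ⋙ (t R).op).leftDerived 0

variable (R) in
/-- The functor `D_L = L^0(Y ∘ ev_R)`: since `Y ∘ ev_R` is contravariant, its zeroth left derived
functor (through injective resolutions) is the zeroth left derived functor of `Y ∘ ev_R` regarded as
a covariant functor on the opposite category. -/
def DL : (FunL R)ᵒᵖ ⥤ FP R := ((evR R).op ⋙ yo R).leftDerived 0

instance : PreservesFiniteColimits (DA R) :=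
  Functor.preservesFiniteColimits_of_preservesCokernels ((w R ⋙ (t R).op).leftDerived 0)

instance : PreservesFiniteColimits (DL R) :=
  Functor.preservesFiniteColimits_of_preservesCokernels (((evR R).op ⋙ yo R).leftDerived 0)

variable (R) in
/-- The composite `D_L D_A`. -/
abbrev DLDA : FP R ⥤ FP R := DA R ⋙ DL R

variable (R) in
/-- The canonical transformation `D_A (X, -) → X ⊗ -`, obtained from `R_0(t ∘ w) ← t ∘ w` and
`w(X, -) ≅ X` (arrows reversed, as it lives in the opposite category). -/
def repToTensor : yo R ⋙ DA R ⟶ (t R).op :=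
  NatTrans.vcomp (G := (yo R ⋙ w R) ⋙ (t R).op)
    (Functor.whiskerLeft (yo R) (w R ⋙ (t R).op).fromLeftDerivedZero)
    (Functor.whiskerRight (wAdj R).counit (t R).op)

variable (R) in
/-- The canonical transformation `L^0(Y ∘ ev_R) → Y ∘ ev_R`. -/
def fromDL : DL R ⟶ (evR R).op ⋙ yo R := ((evR R).op ⋙ yo R).fromLeftDerivedZero

variable (R) in
/-- The transformation `(X ⊗ R, -) → (X, -)` induced by `X → X ⊗ R`. -/
def evTensorToRep : (t R).op ⋙ (evR R).op ⋙ yo R ⟶ yo R :=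
  Functor.whiskerRight (NatTrans.op (unitTensor R)) (yo R)

variable (R) in
/-- `γ` on representables, as a natural transformation in `X`: the composite
`D_L D_A (X, -) → D_L (X ⊗ -) → (X ⊗ R, -) → (X, -)`. -/
def gammaRep : yo R ⋙ DLDA R ⟶ yo R :=
  NatTrans.vcomp (Functor.whiskerRight (repToTensor R) (DL R))
    (NatTrans.vcomp (Functor.whiskerLeft (t R).op (fromDL R)) (evTensorToRep R))

/-- There is exactly one extension of `γ` to a finitely presented functor compatible with all
natural transformations from representables. -/
lemma existsUnique_gamma (F : FP R) : ∃! g : (DLDA R).obj F ⟶ F,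
    ∀ (X : (RMod R)ᵒᵖ) (α : (yo R).obj X ⟶ F),
      (DLDA R).map α ≫ g = (gammaRep R).app X ≫ α := by
  obtain ⟨X, Y, f, π, h⟩ := (isFPFun_iff F.obj).1 F.property
  let p : (yo R).obj (op X) ⟶ F := ObjectProperty.homMk π
  have hc := CokernelCofork.mapIsColimit _ h.isColimit (DLDA R)
  have hep : Epi ((DLDA R).map p) := Cofork.IsColimit.epi hc
  have hf : (DLDA R).map ((yo R).map f.op) ≫ (gammaRep R).app (op X) ≫ p = 0 := by
    have := (gammaRep R).naturality f.op
    rw [← Category.assoc]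
    refine (congrArg (· ≫ p) this).trans ?_
    rw [Category.assoc, h.comp_eq_zero', comp_zero]
  obtain ⟨g, hg⟩ : ∃ g : (DLDA R).obj F ⟶ F, (DLDA R).map p ≫ g = (gammaRep R).app (op X) ≫ p :=
    ⟨hc.desc (CokernelCofork.ofπ _ hf), Cofork.IsColimit.π_desc hc⟩
  refine ⟨g, fun Z α => ?_, fun g' hg' => ?_⟩
  · obtain ⟨a, ha⟩ := exists_lift π h.surj α.hom
    have ha' : (yo R).map a.op ≫ p = α := ObjectProperty.hom_ext _ ha
    rw [← ha', Functor.map_comp, Category.assoc, hg, ← Category.assoc, ← Category.assoc]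
    exact congrArg (· ≫ p) ((gammaRep R).naturality a.op)
  · rw [← cancel_epi ((DLDA R).map p), hg, hg']

variable (R) in
/-- The natural transformation `γ : D_L D_A → 1`: the unique extension of `gammaRep` along
presentations by representables. -/
def gamma : DLDA R ⟶ 𝟭 (FP R) where
  app F := (existsUnique_gamma F).choose
  naturality F G β := by
    obtain ⟨X, Y, f, π, h⟩ := (isFPFun_iff F.obj).1 F.property
    let p : (yo R).obj (op X) ⟶ F := ObjectProperty.homMk π
    have hc := CokernelCofork.mapIsColimit _ h.isColimit (DLDA R)
    have hep : Epi ((DLDA R).map p) := Cofork.IsColimit.epi hc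
    have hF := (existsUnique_gamma F).choose_spec.1 _ p
    have hG := (existsUnique_gamma G).choose_spec.1 _ (p ≫ β)
    rw [← cancel_epi ((DLDA R).map p), ← Category.assoc, ← Functor.map_comp, hG,
      ← Category.assoc, ← Category.assoc, hF]
    rfl

/-- A short exact sequence of right modules that stays exact under `t`. -/
def IsPureExact (S : ShortComplex (RMod R)) : Prop :=
  S.ShortExact ∧ (S.map (t R)).ShortExact

/-- Modules injective with respect to pure exact sequences. -/
def IsPureInjective (M : RMod R) : Prop :=
  ∀ S : ShortComplex (RMod R), IsPureExact S →
    ∀ a : S.X₁ ⟶ M, ∃ b : S.X₂ ⟶ M, S.f ≫ b = a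

/-- `F` arises from a pure exact sequence `0 → X → Y → Z → 0`: there is an exact sequence
`0 → (Z, -) → (Y, -) → (X, -) → F → 0`. -/
def ArisesFromPureExact (F : RMod R ⥤ AddCommGrpCat.{u}) : Prop :=
  ∃ S : ShortComplex (RMod R), IsPureExact S ∧ ∃ π : rep S.X₁ ⟶ F, ∀ A : RMod R,
    Function.Injective ((repMap S.g).app A) ∧
    Function.Exact ((repMap S.g).app A) ((repMap S.f).app A) ∧
    Function.Exact ((repMap S.f).app A) (π.app A) ∧
    Function.Surjective (π.app A)

end Functors
end AGJ

end

/-! Fix a presentation `(Y,-) → (X,-) → F → 0` induced by a map `f : X ⟶ Y`. All six conditions say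
that `f` is a pure monomorphism.

`D_A` carries cokernels to cokernels in the opposite category and `D_A(X,-) ≅ X ⊗ -`, so `D_A F` is
the kernel of `f ⊗ -` and vanishes exactly if `f ⊗ -` is mono (`IsPres.isZero_DA_iff`). Such an `f`
is itself mono, as evaluation at `R` shows, and its cokernel sequence is pure exact because
tensoring preserves cokernels; this gives (2).

On the other side, `F(M)` is the group of maps `X → M` modulo those that extend along `f`, and by
Yoneda it is also `Nat((M,-),F)`. It vanishes for pure-injective `M` if `f` is a pure mono. The
converse needs enough pure-injectives: the character modules `Hom_ℤ(L, ℚ/ℤ)` with `L` finitely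
presented suffice, since extending maps into them along `f` is dual to injectivity of `f ⊗ L`
(`charObj_extends_iff`).

For (5) and (6), the adjunction `t ⊣ ev_R` makes `I(R)` pure-injective for every injective `I`, and
`D_L G` is a quotient of some `(I(R),-)`; so (4) implies (5). Since `γ_F` is a map out of `D_L(D_A
F)`, (5) implies (6). Finally `γ` is epi at `(M,-)` for pure-injective `M` (`epi_gammaRep`): embed
`M ⊗ -` in an injective `I`; then `M → I(R)` is a pure mono, hence split. Naturality of `γ` along
`(M,-) → F` then leads from (6) back to (4). -/

namespace AGJ
noncomputable section

/-! ### Zeroth derived functors and vanishing of cokernels -/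

section Derived
variable {C : Type u₁} [Category.{v₁} C] [Abelian C] [EnoughProjectives C]
  {D : Type u₂} [Category.{v₂} D] [Abelian D] (S : C ⥤ D) [S.Additive]

/-- Both maps come from the degree-zero term of the resolution, and the isomorphisms between
homology and opcycles cancel. For `Y ∘ ev_R` this computes `(I(R),-) → D_L G → (G(R),-)` as the map
induced by `G → I`, which is all that is needed of `D_L` to handle `γ`. -/
lemma leftDerivedZeroAug_fromLeftDerivedZero {X : C} (P : ProjectiveResolution X) :
    leftDerivedZeroAug S P ≫ S.fromLeftDerivedZero.app X = S.map (resAug P) := by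
  rw [P.fromLeftDerivedZero_eq S]
  have h := P.pOpcycles_comp_fromLeftDerivedZero' S
  refine Eq.trans ?_ h
  refine (Category.assoc _ _ _).trans ?_
  unfold toHomologyZero
  refine (Category.assoc _ _ _).trans
    (congrArg (HomologicalComplex.pOpcycles _ _ ≫ ·) ?_)
  refine (congrArg (_ ≫ ·) (Iso.inv_hom_id_assoc _ _)).trans ?_
  exact Iso.inv_hom_id_assoc _ _

/-- Meant for the cokernel `D_A F` in the opposite of the functor category, where being epi amounts
to a monomorphism of functors. -/
lemma isZero_pt_iff_epi {E : Type*} [Category* E] [Preadditive E] {A B : E} {f : A ⟶ B}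
    {c : CokernelCofork f} (hc : IsColimit c) : IsZero c.pt ↔ Epi f := by
  have hep : Epi c.π := Cofork.IsColimit.epi hc
  refine ⟨fun h => ?_, fun h => ?_⟩
  · refine Preadditive.epi_of_cancel_zero f fun g hg => ?_
    have : c.π ≫ hc.desc (CokernelCofork.ofπ g hg) = g :=
      hc.fac (CokernelCofork.ofπ g hg) WalkingParallelPair.one
    rw [← this, h.eq_of_tgt c.π 0, zero_comp]
  · rw [IsZero.iff_id_eq_zero, ← cancel_epi c.π, ← cancel_epi f, ← Category.assoc,
      CokernelCofork.condition, zero_comp, comp_zero, comp_zero]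
end Derived

/-! ### The adjunction between the tensor embedding and evaluation at the ring -/

section Adj
open TensorProduct
variable {R : Type u} [Ring R] {X X' : ModuleCat.{u} Rᵐᵒᵖ} {L L' : ModuleCat.{u} R}

/-- The additive map out of `X ⊗_R L` defined by a balanced biadditive map. -/
def balLift {A : Type*} [AddCommGroup A] (β : X →+ L →+ A)
    (hβ : ∀ (x : X) (r : R) (l : L), β (MulOpposite.op r • x) l = β x (r • l)) :
    BalTensor R X L →+ A :=
  QuotientAddGroup.lift (balancedRel R X L)
    (TensorProduct.liftAddHom β fun n x l => by simp)
    (by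
      unfold balancedRel
      rw [AddSubgroup.closure_le]
      rintro _ ⟨x, r, l, rfl⟩
      simp [hβ])

variable (R) in
/-- The map `R → L` sending `1` to `l`. -/
def elemHom {L : LMod R} (l : L.obj) : regMod R ⟶ L :=
  ObjectProperty.homMk (ModuleCat.ofHom (LinearMap.toSpanSingleton R L.obj l))

lemma elemHom_add {L : LMod R} (l l' : L.obj) : elemHom R (l + l') = elemHom R l + elemHom R l' :=
  regMod_hom_ext fun x => smul_add x l l'

/-- Identifying `l` with the map `1 ↦ l`, this is what makes `z ⊗ l ↦ G(l)(z)` balanced, because the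
right action on `G(R)` is through `rightMul`. -/
lemma rightMul_elemHom {L : LMod R} (r : R) (l : L.obj) :
    rightMul r ≫ elemHom R l = elemHom R (r • l) :=
  regMod_hom_ext fun x => mul_smul x r l

lemma elemHom_comp {L L' : LMod R} (l : L.obj) (g : L ⟶ L') :
    elemHom R l ≫ g = elemHom R (g.hom.hom l) :=
  regMod_hom_ext fun x => map_smul g.hom.hom x l

lemma elemHom_one : elemHom R (L := regMod R) (1 : R) = 𝟙 _ :=
  regMod_hom_ext fun x => mul_one x

/-- The map `G(R) ⊗_R L → G(L)`, `z ⊗ l ↦ G(l)(z)`. -/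
def evTensorHom (G : FunL R) (L : LMod R) : BalTensor R (evObj R G) L.obj →+ G.obj.obj L :=
  balLift
    (AddMonoidHom.mk' (fun z => AddMonoidHom.mk' (fun l : L.obj => G.obj.map (elemHom R l) z)
      fun l l' => by rw [elemHom_add, G.obj.map_add]; rfl)
      fun z z' => by ext l; exact map_add (G.obj.map (elemHom R l)).hom z z')
    fun z r l => by
      change G.obj.map (elemHom R l) (G.obj.map (rightMul r) z) = G.obj.map (elemHom R (r • l)) z
      rw [← rightMul_elemHom, G.obj.map_comp]
      rfl

variable (R) in
/-- The counit `G(R) ⊗ - → G`. -/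
def evTensor : evR R ⋙ t R ⟶ 𝟭 (FunL R) where
  app G := ObjectProperty.homMk
    { app := fun L => AddCommGrpCat.ofHom (evTensorHom G L)
      naturality := fun L L' g => by
        ext1
        refine balTensor_hom_ext fun z l => ?_
        change G.obj.map (elemHom R (g.hom.hom l)) z = G.obj.map g (G.obj.map (elemHom R l) z)
        rw [← elemHom_comp, G.obj.map_comp]
        rfl }
  naturality G H α := by
    ext L : 4
    refine balTensor_hom_ext fun z l => ?_
    exact (ConcreteCategory.congr_hom (α.hom.naturality (elemHom R l)) z).symm

variable (R) in
/-- The tensor embedding is left adjoint to evaluation at the ring. -/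
def tensorAdj : t R ⊣ evR R where
  unit := unitTensor R
  counit := evTensor R
  left_triangle_components X := by
    ext L : 4
    refine balTensor_hom_ext fun x l => ?_
    -- The unit turns `x ⊗ l` into `(x ⊗ 1) ⊗ l`; the counit then applies to `x ⊗ 1` the map `R → L`
    -- with `1 ↦ l`.
    change balTmul (L := L.obj) x ((1 : R) • l) = balTmul x l
    rw [one_smul]
  right_triangle_components G := by
    ext z
    change G.obj.map (elemHom R (L := regMod R) (1 : R)) z = z
    rw [elemHom_one, G.obj.map_id]
    rfl

instance : (t R).IsLeftAdjoint := (tensorAdj R).isLeftAdjoint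

/-! ### Pure monomorphisms and pure-injective modules -/

lemma balTmul_one_eq_zero {x : X} (h : balTmul (L := ModuleCat.of R R) x (1 : R) = 0) : x = 0 := by
  -- `β` is `x ⊗ r ↦ x r`, a left inverse of `x ↦ x ⊗ 1`.
  let β : BalTensor R X (ModuleCat.of R R) →+ X := balLift
    (AddMonoidHom.mk' (fun x => AddMonoidHom.mk' (fun r : R => MulOpposite.op r • x)
      fun r s => by rw [MulOpposite.op_add, add_smul])
      fun x y => by ext r; exact smul_add _ _ _)
    fun x r s => by
      change MulOpposite.op s • MulOpposite.op r • x = MulOpposite.op (r * s) • x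
      rw [MulOpposite.op_mul, mul_smul]
  have h1 : β (balTmul (L := ModuleCat.of R R) x (1 : R)) = MulOpposite.op (1 : R) • x := rfl
  rw [h, map_zero, MulOpposite.op_one, one_smul] at h1
  exact h1.symm

/-- Evaluate at `R`: if `f x = 0` then `f x ⊗ 1 = 0`, so `x ⊗ 1 = 0` and `x = 0`. Hence purity of a
map can be expressed by `Mono ((t R).map f)` alone. -/
lemma mono_of_mono_tensor (f : X ⟶ X') [Mono ((t R).map f)] : Mono f := by
  rw [ModuleCat.mono_iff_injective, injective_iff_map_eq_zero]
  intro x hx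
  refine balTmul_one_eq_zero (R := R) ?_
  refine funL_inj R ((t R).map f) (regMod R) ?_
  refine Eq.trans ?_ (map_zero (((t R).map f).hom.app (regMod R)).hom).symm
  change balTmul (L := ModuleCat.of R R) (f.hom x) (1 : R) = 0
  rw [show f.hom x = 0 from hx, ← zero_add (balTmul _ _), ← sub_eq_zero]
  have := add_balTmul (L := ModuleCat.of R R) (0 : X') 0 (1 : R)
  rw [add_zero] at this
  rw [zero_add, sub_zero]
  exact left_eq_add.1 this

/-- The cokernel sequence of a monomorphism that stays one under `t` is pure exact. -/
lemma isPureExact_cokernel (f : X ⟶ X') [Mono ((t R).map f)] :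
    IsPureExact (ShortComplex.mk f (cokernel.π f) (cokernel.condition f)) := by
  have := mono_of_mono_tensor f
  have hex : (ShortComplex.mk f (cokernel.π f) (cokernel.condition f)).Exact :=
    ShortComplex.exact_of_g_is_cokernel _ (cokernelIsCokernel f)
  refine ⟨{ exact := hex, mono_f := this, epi_g := inferInstanceAs (Epi (cokernel.π f)) }, ?_⟩
  -- As a left adjoint, `t` keeps the cokernel, so only injectivity on the left could fail, and that
  -- is assumed.
  have := (tensorAdj R).leftAdjoint_preservesColimits.{0, 0}
  have : PreservesFiniteColimits (t R) := PreservesColimitsOfSize.preservesFiniteColimits (t R)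
  exact
    { exact := ShortComplex.exact_of_g_is_cokernel _
        (CokernelCofork.mapIsColimit _ (cokernelIsCokernel f) (t R))
      mono_f := ‹Mono ((t R).map f)›
      epi_g := inferInstanceAs (Epi ((t R).map (cokernel.π f))) }

/-- Replaces pure exact sequences by single maps: the cokernel of `f` supplies the third term. -/
lemma IsPureInjective.exists_extension {M : RMod R} (hM : IsPureInjective M) (f : X ⟶ X')
    [Mono ((t R).map f)] (a : X ⟶ M) : ∃ b : X' ⟶ M, f ≫ b = a :=
  hM _ (isPureExact_cokernel f) a

/-- The value at the ring of an injective functor is pure-injective. -/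
lemma isPureInjective_evR (I : FunL R) [Injective I] : IsPureInjective ((evR R).obj I) := by
  intro S hS a
  have : Mono ((t R).map S.f) := hS.2.mono_f
  -- Transpose `a` to a map `S.X₁ ⊗ - → I`, extend it along the mono `S.f ⊗ -` by injectivity of
  -- `I`, and transpose back.
  refine ⟨(tensorAdj R).homEquiv _ _ (Injective.factorThru
    (((tensorAdj R).homEquiv _ _).symm a) ((t R).map S.f)), ?_⟩
  rw [← (tensorAdj R).homEquiv_naturality_left, Injective.comp_factorThru,
    Equiv.apply_symm_apply]

/-- If `t X → I` is mono, then so is `t` of its adjunct `X → I(R)`. -/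
lemma mono_tensor_homEquiv {I : FunL R} (i : (t R).obj X ⟶ I) [Mono i] :
    Mono ((t R).map ((tensorAdj R).homEquiv _ _ i)) := by
  -- The mono `i` factors through `t` of its adjunct, and a first factor of a mono is mono.
  have h : (t R).map ((tensorAdj R).homEquiv _ _ i) ≫ (tensorAdj R).counit.app I = i :=
    ((tensorAdj R).homEquiv_counit _ _ _).symm.trans (Equiv.symm_apply_apply _ _)
  have : Mono ((t R).map ((tensorAdj R).homEquiv _ _ i) ≫ (tensorAdj R).counit.app I) := by
    rwa [h]
  exact mono_of_mono _ ((tensorAdj R).counit.app I)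

/-! ### Character modules detect pure monomorphisms -/

variable (R) in
/-- The character module `Hom_ℤ(L, ℚ/ℤ)` of a left module, as a right module. -/
def charObj (L : ModuleCat.{u} R) : RMod R :=
  letI : Module Rᵐᵒᵖ (CharacterModule L) :=
    { smul := fun r c => AddMonoidHom.comp (c : L →+ AddCircle (1 : ℚ))
        (DistribSMul.toAddMonoidHom L r.unop)
      one_smul := fun c => CharacterModule.ext _ fun l => congrArg c (one_smul R l)
      mul_smul := fun r s c => CharacterModule.ext _ fun l => congrArg c (mul_smul s.unop r.unop l)
      smul_zero := fun _ => rfl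
      smul_add := fun _ _ _ => rfl
      add_smul := fun r s c => CharacterModule.ext _ fun l =>
        (congrArg c (add_smul r.unop s.unop l)).trans (map_add c _ _)
      zero_smul := fun c => CharacterModule.ext _ fun l =>
        (congrArg c (zero_smul R l)).trans (map_zero c) }
  ModuleCat.of Rᵐᵒᵖ (CharacterModule L)

variable (R) in
/-- Evaluation of characters. -/
def charVal (L : ModuleCat.{u} R) : charObj R L →+ L →+ AddCircle (1 : ℚ) :=
  AddMonoidHom.id (L →+ AddCircle (1 : ℚ))

lemma charVal_smul (r : R) (c : charObj R L) (l : L) :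
    charVal R L (MulOpposite.op r • c) l = charVal R L c (r • l) := rfl

lemma charVal_ext {c d : charObj R L} (h : ∀ l, charVal R L c l = charVal R L d l) : c = d :=
  AddMonoidHom.ext (M := L) (N := AddCircle (1 : ℚ)) h

/-- The character of `X ⊗ L` attached to a map `X → Hom_ℤ(L, ℚ/ℤ)`. -/
def charUncurry (a : X ⟶ charObj R L) : BalTensor R X L →+ AddCircle (1 : ℚ) :=
  balLift ((charVal R L).comp a.hom.toAddMonoidHom) fun x r l => by
    change charVal R L (a.hom (MulOpposite.op r • x)) l = charVal R L (a.hom x) (r • l)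
    rw [map_smul, charVal_smul]

/-- The map `X → Hom_ℤ(L, ℚ/ℤ)` attached to a character of `X ⊗ L`. -/
def charCurry (c : BalTensor R X L →+ AddCircle (1 : ℚ)) : X ⟶ charObj R L :=
  ModuleCat.ofHom (X := X) (Y := charObj R L)
    { toFun := fun x => (AddMonoidHom.mk' (fun l => c (balTmul x l))
        fun l l' => (congrArg c (balTmul_add x l l')).trans (map_add c _ _) :
          L →+ AddCircle (1 : ℚ))
      map_add' := fun x y => charVal_ext fun l =>
        (congrArg c (add_balTmul x y l)).trans (map_add c _ _)
      map_smul' := fun r x => charVal_ext fun l => congrArg c (balTmul_balanced x r.unop l) }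

/-- Every map to the character module of `L` extends along `f` exactly if `f ⊗ L` is injective. -/
lemma charObj_extends_iff (f : X ⟶ X') (L : ModuleCat.{u} R) :
    (∀ a : X ⟶ charObj R L, ∃ b : X' ⟶ charObj R L, f ≫ b = a) ↔
      Function.Injective (balMap f (𝟙 L)) := by
  -- Since `ℚ/ℤ` is an injective cogenerator, `f ⊗ L` is injective exactly if every character of `X
  -- ⊗ L` extends along it. Currying turns such characters into maps `X → Hom_ℤ(L, ℚ/ℤ)`, and
  -- restriction along `f ⊗ L` into composition with `f`.
  rw [show Function.Injective (balMap f (𝟙 L)) ↔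
      Function.Injective (balMap f (𝟙 L)).toIntLinearMap from Iff.rfl,
    ← CharacterModule.dual_surjective_iff_injective]
  refine ⟨fun h c => ?_, fun h a => ?_⟩
  · obtain ⟨b, hb⟩ := h (charCurry c)
    refine ⟨charUncurry b, balTensor_hom_ext fun x l => ?_⟩
    exact congrArg (fun d => charVal R L d l) (ConcreteCategory.congr_hom hb x)
  · obtain ⟨c, hc⟩ := h (charUncurry a)
    refine ⟨charCurry c, ModuleCat.hom_ext (LinearMap.ext fun x => charVal_ext fun l => ?_)⟩
    exact DFunLike.congr_fun hc (balTmul x l)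

/-- Finite presentation of `L` matters here only because purity is tested on functors defined on
finitely presented modules. -/
lemma isPureInjective_charObj (L : LMod R) : IsPureInjective (charObj R L.obj) := by
  intro S hS
  have : Mono ((t R).map S.f) := hS.2.mono_f
  exact (charObj_extends_iff S.f L.obj).2 (funL_inj R ((t R).map S.f) L)

/-- A map along which maps to pure-injectives extend is a pure monomorphism. -/
lemma mono_tensor_of_extends (f : X ⟶ X')
    (h : ∀ M : RMod R, IsPureInjective M → ∀ a : X ⟶ M, ∃ b : X' ⟶ M, f ≫ b = a) :
    Mono ((t R).map f) :=
  funL_mono R _ fun L => (charObj_extends_iff f L.obj).1 (h _ (isPureInjective_charObj L))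

end Adj
-- Vanishing of `D_A`, quotients onto `D_L G`, and `γ` at pure-injectives
section Main
variable {R : Type u} [Ring R]

instance : (yo R).Full := inferInstanceAs ((isFPFun R).lift preadditiveCoyoneda _).Full

instance : (yo R).Faithful := inferInstanceAs ((isFPFun R).lift preadditiveCoyoneda _).Faithful

/-- Two reasons combine: `(X,-)` is projective, so the derived functor agrees there with `t ∘ w`,
and `Y` is fully faithful, so the counit `w(X,-) ≅ X` is invertible. -/
instance (X : (RMod R)ᵒᵖ) : IsIso ((repToTensor R).app X) := by
  have h1 : IsIso ((w R ⋙ (t R).op).fromLeftDerivedZero.app ((yo R).obj X)) := inferInstance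
  have h2 : IsIso ((t R).op.map ((wAdj R).counit.app X)) := inferInstance
  exact @IsIso.comp_isIso _ _ _ _ _ _ _ h1 h2

lemma epi_iff_of_comm_sq {E : Type*} [Category* E] {A B A' B' : E} {a : A ⟶ B} {b : A' ⟶ B'}
    {u : A ⟶ A'} {v : B ⟶ B'} [IsIso u] [IsIso v] (h : a ≫ v = u ≫ b) : Epi a ↔ Epi b := by
  rw [← epi_comp_iff_of_isIso a v, h, epi_comp_iff_of_epi]

/-- `D_A F` vanishes exactly if the map presenting `F` is a pure monomorphism. -/
lemma IsPres.isZero_DA_iff {X Y : RMod R} {F : FP R} {f : X ⟶ Y} {π : rep X ⟶ F.obj}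
    (h : IsPres f π) : IsZero ((DA R).obj F).unop ↔ Mono ((t R).map f) := by
  have hc := CokernelCofork.mapIsColimit _ h.isColimit (DA R)
  have hn : (DA R).map ((yo R).map f.op) ≫ (repToTensor R).app (op X) =
      (repToTensor R).app (op Y) ≫ ((t R).map f).op := (repToTensor R).naturality f.op
  have h1 : IsZero ((DA R).obj F).unop ↔ IsZero ((DA R).obj F) := ⟨fun h => h.op, fun h => h.unop⟩
  refine (h1.trans (isZero_pt_iff_epi hc)).trans ?_
  -- The square `hn` replaces `D_A(f,-)` by `f ⊗ -` in the opposite category, where epi means mono.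
  exact (epi_iff_of_comm_sq hn).trans (op_epi_iff ((t R).map f))

/-- `D_L G` is a quotient of `(I(R), -)` for some injective `I`. -/
lemma exists_epi_to_DL (G : FunL R) : ∃ (I : FunL R) (_ : Injective I)
    (p : (yo R).obj (op ((evR R).obj I)) ⟶ (DL R).obj (op G)), Epi p := by
  -- A projective resolution of `op G` is an injective resolution of `G`, so its degree-zero term is
  -- the required `I`.
  let P := projectiveResolution (op G)
  have hP : Projective (P.complex.X 0) := P.projective 0
  exact ⟨(P.complex.X 0).unop, inferInstance,
    leftDerivedZeroAug ((evR R).op ⋙ yo R) P,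
    inferInstanceAs (Epi (leftDerivedZeroAug ((evR R).op ⋙ yo R) P))⟩

/-- A section of a composite, followed by the first factor, is a section of the remaining factors.
-/
lemma epi_comp_of_split {E : Type*} [Category* E] {A B C D : E} {s : D ⟶ A} {a : A ⟶ B} {b : B ⟶ C}
    {c : C ⟶ D} (h : s ≫ (a ≫ b) ≫ c = 𝟙 D) : Epi (b ≫ c) :=
  have : IsSplitEpi (b ≫ c) := ⟨⟨⟨s ≫ a, by simpa using h⟩⟩⟩
  inferInstance

/-- `γ` is an epimorphism at `(M, -)` if `M` is pure-injective. -/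
lemma epi_gammaRep {M : RMod R} (hM : IsPureInjective M) : Epi ((gammaRep R).app (op M)) := by
  -- The first factor of `γ` at `(M,-)` is `D_L` of an isomorphism, so it can be dropped.
  suffices H : Epi ((fromDL R).app (op ((t R).obj M)) ≫ (evTensorToRep R).app (op M)) from
    @epi_comp _ _ _ _ _ ((DL R).map ((repToTensor R).app (op M))) inferInstance _ H
  let P := projectiveResolution (op ((t R).obj M))
  have hmono : Mono (resAug P).unop := inferInstance
  let i : (t R).obj M ⟶ (P.complex.X 0).unop := (resAug P).unop
  have hpure := mono_tensor_homEquiv i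
  -- Extending the identity of `M` along the pure mono `M → I(R)` gives a retraction `r`.
  obtain ⟨r, hr⟩ := hM.exists_extension ((tensorAdj R).homEquiv _ _ i) (𝟙 M)
  have h1 : leftDerivedZeroAug ((evR R).op ⋙ yo R) P ≫ (fromDL R).app (op ((t R).obj M)) =
    (yo R).map ((evR R).map i).op := leftDerivedZeroAug_fromLeftDerivedZero _ P
  -- The adjunct `M → I(R)` is the unit followed by `i` evaluated at `R`; applying `(-,-)` to `hr`
  -- therefore makes `(r,-)` a section of `(I(R),-) → D_L(M ⊗ -) → (M ⊗ R,-) → (M,-)`.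
  have h2 : (yo R).map r.op ≫ (yo R).map ((evR R).map i).op ≫
      (yo R).map ((tensorAdj R).unit.app M).op = 𝟙 _ := by
    rw [← Functor.map_comp, ← Functor.map_comp, ← op_comp, ← op_comp]
    exact (congrArg (fun k => (yo R).map k.op) hr).trans ((yo R).map_id _)
  exact epi_comp_of_split ((congrArg (fun β => (yo R).map r.op ≫ β ≫
    (yo R).map ((tensorAdj R).unit.app M).op) h1).trans h2)

end Main
end
end AGJ

/-! ### The six equivalent conditions -/

open AGJ in
theorem mainTheorem5 (R : Type u) [Ring R] (F : AGJ.FP R) :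
    List.TFAE
      [IsZero ((AGJ.DA R).obj F).unop,
       AGJ.ArisesFromPureExact F.obj,
       ∀ M : AGJ.RMod R, AGJ.IsPureInjective M → IsZero (F.obj.obj M),
       ∀ M : AGJ.RMod R, AGJ.IsPureInjective M → ∀ α : AGJ.rep M ⟶ F.obj, α = 0,
       ∀ G : AGJ.FunL R, ∀ α : (AGJ.DL R).obj (op G) ⟶ F, α = 0,
       (AGJ.gamma R).app F = 0] := by
  obtain ⟨X, Y, f, π, h⟩ := (isFPFun_iff F.obj).1 F.property
  have hadd := isFPFun_additive F.property
  tfae_have 1 → 2 := by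
    intro hz
    have := h.isZero_DA_iff.1 hz
    have hS := isPureExact_cokernel f
    refine ⟨_, hS, π, fun A => ⟨?_, ?_, fun x => h.zero_iff x, fun z => h.surj z⟩⟩
    · intro x y hxy
      exact (cancel_epi (cokernel.π f)).1 hxy
    · intro x
      refine ⟨fun hx => ⟨cokernel.desc f x hx, cokernel.π_desc f x hx⟩, ?_⟩
      rintro ⟨y, rfl⟩
      exact cokernel.condition_assoc f y |>.trans zero_comp
  tfae_have 2 → 3 := by
    rintro ⟨S, hS, π, hex⟩ M hM
    refine @AddCommGrpCat.isZero_of_subsingleton _ (subsingleton_of_forall_eq 0 fun z => ?_)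
    obtain ⟨-, -, h1, h2⟩ := hex M
    obtain ⟨x, rfl⟩ := h2 z
    -- The element of `F(M)` represented by `x` is zero because `x` extends along `S.f`.
    exact (h1 x).2 (hM S hS x)
  tfae_have 3 → 4 := fun h3 M hM α => ev_ext <| by
    have := AddCommGrpCat.subsingleton_of_isZero (h3 M hM)
    exact Subsingleton.elim _ _
  tfae_have 4 → 1 := by
    intro h4
    -- A map `a : X ⟶ M` extends along `f` once its class in `F(M)` vanishes; by Yoneda that class
    -- is the transformation `repMap a ≫ π`, which (4) kills.
    refine h.isZero_DA_iff.2 (mono_tensor_of_extends f fun M hM a => (h.zero_iff a).1 ?_)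
    have := h4 M hM (repMap a ≫ π)
    have h5 : ev (repMap a ≫ π) (𝟙 M) = 0 := by rw [this]; rfl
    rwa [ev_repMap, Category.comp_id] at h5
  tfae_have 4 → 5 := by
    intro h4 G α
    obtain ⟨I, _, p, _⟩ := exists_epi_to_DL G
    rw [← cancel_epi p, comp_zero]
    exact ObjectProperty.hom_ext _ (h4 _ (isPureInjective_evR I) (p ≫ α).hom)
  -- `γ_F` is itself a transformation `D_L G → F`, with `G = D_A F`.
  tfae_have 5 → 6 := fun h5 => h5 ((DA R).obj F).unop _
  tfae_have 6 → 4 := by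
    intro h6 M hM α
    -- Compatibility of `γ_F` with `α` reads `D_L D_A α ≫ γ_F = γ_(M,-) ≫ α`; the left side is zero
    -- and `γ_(M,-)` is epi, so `α = 0`.
    have hg := (existsUnique_gamma F).choose_spec.1 (op M) (ObjectProperty.homMk α)
    have h6' : (existsUnique_gamma F).choose = 0 := h6
    have := epi_gammaRep hM
    rw [h6', comp_zero, ← comp_zero (f := (gammaRep R).app (op M)), cancel_epi] at hg
    exact congrArg (fun β => β.hom) hg.symm
  tfae_finish
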